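/- **Conventions.** A *quantaloid* is a category whose homs are complete lattices and whose composition preserves suprema in each variable; an *involution* on it is an identity-on-objects, contravariant map $f\mapsto f^{\sf o}$ on arrows that preserves identities and suprema, satisfies $(gf)^{\sf o}=f^{\sf o}g^{\sf o}$ and $f^{\sf oo}=f$. For a small site $({\cal C},J)$, the involutive quantaloid ${\cal R}({\cal C},J)$ of *closed cribles* has the objects of ${\cal C}$; an arrow $X\to Y$ is a set of spans $(f:U\to X,\ g:U\to Y)$ in ${\cal C}$ that is stable under precomposition and contains $(f,g)$ as soon as it contains $(fk,gk)$ for all $k$ in some $J$-covering sieve on $U$; arrows are ordered by inclusion, composition is the closure of the relational composition of spans, and the involution reverses spans. A *small quantaloid of closed cribles* is a small involutive quantaloid ${\cal Q}$ that is equivalent, as an involutive quantaloid, to some ${\cal R}({\cal C},J)$. For a small quantaloid ${\cal Q}$, a ${\cal Q}$-category $\mathbb{A}$ has a set of objects $x$ with types $tx\in{\cal Q}$ and hom-arrows $\mathbb{A}(y,x):tx\to ty$ such that $1_{tx}\le\mathbb{A}(x,x)$ and $\mathbb{A}(z,y)\circ\mathbb{A}(y,x)\le\mathbb{A}(z,x)$.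 ${\sf Cat}({\cal Q})$ is the locally ordered category of ${\cal Q}$-categories and (type-preserving) functors, with $F\le G:\mathbb{A}\to\mathbb{B}$ iff $1_{tx}\le\mathbb{B}(Fx,Gx)$ for all $x$; ${\sf Dist}({\cal Q})$ is the quantaloid of ${\cal Q}$-categories and distributors. $\mathbb{A}$ is *Cauchy complete* if every left adjoint distributor into $\mathbb{A}$ is of the form $\mathbb{A}(-,F-)$ for a functor $F$. ${\sf Cat}_{\sf cc}({\cal Q})$ and ${\sf Dist}_{\sf cc}({\cal Q})$ are the full subcategories of ${\sf Cat}({\cal Q})$ and ${\sf Dist}({\cal Q})$ on the Cauchy complete ${\cal Q}$-categories. If ${\cal Q}$ is involutive, $\mathbb{A}$ is *symmetric* if $\mathbb{A}(x,y)=\mathbb{A}(y,x)^{\sf o}$ for all $x,y$; a symmetric $\mathbb{A}$ is *symmetrically complete* if every distributor $\Phi$ from a symmetric ${\cal Q}$-category into $\mathbb{A}$ that is left adjoint to its involute $\Phi^{\sf o}$, where $\Phi^{\sf o}(b,a)=\Phi(a,b)^{\sf o}$, is of the form $\mathbb{A}(-,F-)$. An object $D$ of a locally ordered category ${\cal K}$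 is *discrete* if for every $X\in{\cal K}$ the order on ${\cal K}(X,D)$ is symmetric. ${\cal Q}_{\sf ssi}$ is the involutive quantaloid obtained from ${\cal Q}$ by splitting all symmetric idempotents: its objects are the $e:A\to A$ with $e\circ e=e=e^{\sf o}$, and its arrows $e\to e'$ are the $x$ in ${\cal Q}$ with $e'\circ x=x=x\circ e$. ${\sf Sh}({\cal Q})$ and ${\sf Rel}({\cal Q})$ are the full subcategories of ${\sf Cat}({\cal Q}_{\sf ssi})$ and ${\sf Dist}({\cal Q}_{\sf ssi})$ on the symmetric and symmetrically complete ${\cal Q}_{\sf ssi}$-categories. In this statement ${\sf Ord}({\cal Q})$ and ${\sf Idl}({\cal Q})$ denote the orders relative to the set of all symmetric idempotents: ${\sf Ord}({\cal Q})={\sf Cat}_{\sf cc}({\cal Q}_{\sf ssi})$ and ${\sf Idl}({\cal Q})={\sf Dist}_{\sf cc}({\cal Q}_{\sf ssi})$. An object of ${\sf Idl}({\cal Q})$ is called discrete if it is discrete in ${\sf Ord}({\cal Q})$. **Proposition (Symmetric vs. discrete).** Let ${\cal Q}$ be a small quantaloid of closed cribles. 1. A Cauchy complete ${\cal Q}$-category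 is a discrete object of ${\sf Cat}_{\sf cc}({\cal Q})$ if and only if it is symmetric. 2. ${\sf Sh}({\cal Q})$ is the full subcategory of discrete objects of ${\sf Ord}({\cal Q})$: every symmetric and symmetrically complete ${\cal Q}_{\sf ssi}$-category is Cauchy complete, and the resulting full (locally full) inclusion ${\sf Sh}({\cal Q})\to{\sf Ord}({\cal Q})$ has as its image exactly the discrete objects. 3. ${\sf Rel}({\cal Q})$ is the full subquantaloid of discrete objects of ${\sf Idl}({\cal Q})$: the full, supremum-preserving inclusion ${\sf Rel}({\cal Q})\to{\sf Idl}({\cal Q})$ has as its image exactly the discrete objects. These are also exactly the objects $D$ of ${\sf Idl}({\cal Q})$ for which $\Phi\le\Psi$ implies $\Psi\le\Phi$ for all left adjoints $\Phi,\Psi:X\to D$ in ${\sf Idl}({\cal Q})$. -/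

import Mathlib

open CategoryTheory

universe v u

/-! ### Locally ordered categories and quantaloids -/

/-- A category whose hom-sets carry a preorder that composition preserves. -/
class LocallyOrdered (K : Type u) extends Category.{v} K where
  [homPreorder : ∀ X Y : K, Preorder (X ⟶ Y)]
  comp_mono : ∀ {X Y Z : K} {f f' : X ⟶ Y} {g g' : Y ⟶ Z}, f ≤ f' → g ≤ g' → f ≫ g ≤ f' ≫ g'

attribute [reducible, instance] LocallyOrdered.homPreorder

/-- An object `D` of a locally ordered category is discrete when, for every object `X`, the order
on the morphisms `X ⟶ D` is symmetric. -/
def IsDiscreteObj {K : Type u} [LocallyOrdered.{v} K] (D : K) : Prop :=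
  ∀ (X : K) (f g : X ⟶ D), f ≤ g → g ≤ f

/-- A quantaloid: the homs are complete lattices and composition preserves suprema in each
variable. Composition is written in diagrammatic order: `f ≫ g` is `g ∘ f`. -/
class Quantaloid (Q : Type u) extends Category.{v} Q where
  [homLattice : ∀ X Y : Q, CompleteLattice (X ⟶ Y)]
  sSup_comp : ∀ {X Y Z : Q} (s : Set (X ⟶ Y)) (g : Y ⟶ Z), sSup s ≫ g = ⨆ f ∈ s, f ≫ g
  comp_sSup : ∀ {X Y Z : Q} (f : X ⟶ Y) (s : Set (Y ⟶ Z)), f ≫ sSup s = ⨆ g ∈ s, f ≫ g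

attribute [reducible, instance] Quantaloid.homLattice

/-- An involutive quantaloid: an identity-on-objects, contravariant, supremum-preserving
involution `f ↦ f°`. -/
class InvolutiveQuantaloid (Q : Type u) extends Quantaloid.{v} Q where
  invol : ∀ {X Y : Q}, (X ⟶ Y) → (Y ⟶ X)
  invol_invol : ∀ {X Y : Q} (f : X ⟶ Y), invol (invol f) = f
  invol_id : ∀ X : Q, invol (𝟙 X) = 𝟙 X
  invol_comp : ∀ {X Y Z : Q} (f : X ⟶ Y) (g : Y ⟶ Z), invol (f ≫ g) = invol g ≫ invol f
  invol_sSup : ∀ {X Y : Q} (s : Set (X ⟶ Y)), invol (sSup s) = ⨆ f ∈ s, invol f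

namespace Quantaloid

section

variable {Q : Type u} [Quantaloid.{v} Q] {X Y Z : Q}

theorem comp_le_comp {f f' : X ⟶ Y} {g g' : Y ⟶ Z} (hf : f ≤ f') (hg : g ≤ g') :
    f ≫ g ≤ f' ≫ g' := by
  have h1 : f ≫ g ≤ f' ≫ g := by
    have h := sSup_comp {f, f'} g
    rw [sSup_pair, sup_eq_right.2 hf] at h
    rw [h]
    exact le_iSup₂_of_le f (by simp) le_rfl
  have h2 : f' ≫ g ≤ f' ≫ g' := by
    have h := comp_sSup f' {g, g'}
    rw [sSup_pair, sup_eq_right.2 hg] at h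
    rw [h]
    exact le_iSup₂_of_le g (by simp) le_rfl
  exact h1.trans h2

theorem iSup_comp {ι : Sort*} (f : ι → (X ⟶ Y)) (g : Y ⟶ Z) :
    (⨆ i, f i) ≫ g = ⨆ i, f i ≫ g := by
  rw [iSup, sSup_comp, iSup_range]

theorem comp_iSup {ι : Sort*} (f : X ⟶ Y) (g : ι → (Y ⟶ Z)) :
    f ≫ (⨆ i, g i) = ⨆ i, f ≫ g i := by
  rw [iSup, comp_sSup, iSup_range]

/-- `f ⊣ g` in a quantaloid. -/
def Adj (f : X ⟶ Y) (g : Y ⟶ X) : Prop :=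
  𝟙 X ≤ f ≫ g ∧ g ≫ f ≤ 𝟙 Y

def IsLeftAdjoint (f : X ⟶ Y) : Prop :=
  ∃ g : Y ⟶ X, Adj f g

/-- For an object of a quantaloid: the order on the left adjoints into `D` is symmetric, that is,
`D` is a discrete object of the locally ordered category of left adjoints. -/
def IsMapDiscreteObj (D : Q) : Prop :=
  ∀ (X : Q) (f g : X ⟶ D), IsLeftAdjoint f → IsLeftAdjoint g → f ≤ g → g ≤ f

end

end Quantaloid

open Quantaloid InvolutiveQuantaloid

theorem InvolutiveQuantaloid.invol_mono {Q : Type u} [InvolutiveQuantaloid.{v} Q] {X Y : Q}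
    {f g : X ⟶ Y} (h : f ≤ g) : invol f ≤ invol g := by
  have h' := invol_sSup {f, g}
  rw [sSup_pair, sup_eq_right.2 h] at h'
  rw [h']
  exact le_iSup₂_of_le f (by simp) le_rfl

/-- A full subcategory of a locally ordered category is locally ordered. -/
instance fullSubLocallyOrdered {K : Type u} [LocallyOrdered.{v} K] (P : ObjectProperty K) :
    LocallyOrdered.{v} P.FullSubcategory where
  toCategory := inferInstance
  homPreorder _ _ := Preorder.lift fun f => f.hom
  comp_mono hf hg := LocallyOrdered.comp_mono (K := K) hf hg

/-- The hom-lattice of a full subcategory of a quantaloid, with the order and the suprema of the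
ambient quantaloid. -/
abbrev fullSubLattice {Q : Type u} [Quantaloid.{v} Q] (P : ObjectProperty Q)
    (A B : P.FullSubcategory) : CompleteLattice (A ⟶ B) :=
  letI : PartialOrder (A ⟶ B) :=
    PartialOrder.lift (fun f => f.hom) fun _ _ h => ObjectProperty.hom_ext P h
  letI : SupSet (A ⟶ B) := ⟨fun s => ObjectProperty.homMk (⨆ f ∈ s, f.hom)⟩
  completeLatticeOfSup (A ⟶ B) fun s =>
    ⟨fun f hf => le_iSup₂ (f := fun (f : A ⟶ B) (_ : f ∈ s) => f.hom) f hf,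
      fun _ hg => iSup₂_le fun _ hf => hg hf⟩

/-- A full subcategory of a quantaloid is a quantaloid. -/
instance fullSubQuantaloid {Q : Type u} [Quantaloid.{v} Q] (P : ObjectProperty Q) :
    Quantaloid.{v} P.FullSubcategory :=
  letI := fullSubLattice P
  { toCategory := inferInstance
    homLattice := fullSubLattice P
    sSup_comp := fun {A B C} s g => by
      refine le_antisymm ?_ (iSup₂_le fun f hf =>
        comp_le_comp (Q := Q) (le_sSup (a := f) hf : f ≤ sSup s) le_rfl)
      change (⨆ f ∈ s, f.hom) ≫ g.hom ≤ (⨆ f ∈ s, f ≫ g).hom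
      simp only [iSup_comp]
      exact iSup₂_le fun f hf => le_iSup₂ (f := fun f (_ : f ∈ s) => f ≫ g) f hf
    comp_sSup := fun {A B C} f s => by
      refine le_antisymm ?_ (iSup₂_le fun g hg =>
        comp_le_comp (Q := Q) le_rfl (le_sSup (a := g) hg : g ≤ sSup s))
      change f.hom ≫ (⨆ g ∈ s, g.hom) ≤ (⨆ g ∈ s, f ≫ g).hom
      simp only [comp_iSup]
      exact iSup₂_le fun g hg => le_iSup₂ (f := fun g (_ : g ∈ s) => f ≫ g) g hg }

/-! ### The quantaloid of closed cribles of a site -/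

/-- A closed crible between two objects of a site: a set of spans that is stable under
precomposition and contains every span that belongs to it locally. -/
@[ext]
structure ClosedCrible {C : Type u} [Category.{v} C] (J : GrothendieckTopology C) (X Y : C) where
  rel : ∀ ⦃U : C⦄, (U ⟶ X) → (U ⟶ Y) → Prop
  precomp : ∀ ⦃U V : C⦄ (k : V ⟶ U) {f : U ⟶ X} {g : U ⟶ Y}, rel f g → rel (k ≫ f) (k ≫ g)
  closed : ∀ ⦃U : C⦄ (f : U ⟶ X) (g : U ⟶ Y) (S : Sieve U), S ∈ J U →
    (∀ ⦃V : C⦄ (k : V ⟶ U), S k → rel (k ≫ f) (k ≫ g)) → rel f g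

namespace ClosedCrible

variable {C : Type u} [Category.{v} C] {J : GrothendieckTopology C} {X Y Z W : C}

instance : PartialOrder (ClosedCrible J X Y) where
  le R S := ∀ ⦃U : C⦄ (f : U ⟶ X) (g : U ⟶ Y), R.rel f g → S.rel f g
  le_refl _ _ _ _ h := h
  le_trans _ _ _ h h' _ f g hf := h' f g (h f g hf)
  le_antisymm R S h h' := by
    ext U f g
    exact ⟨h f g, h' f g⟩

/-- The closure of a crible of spans: the spans that belong to it locally. -/
def gen (J : GrothendieckTopology C) (K : ∀ ⦃U : C⦄, (U ⟶ X) → (U ⟶ Y) → Prop)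
    (hK : ∀ ⦃U V : C⦄ (k : V ⟶ U) (f : U ⟶ X) (g : U ⟶ Y), K f g → K (k ≫ f) (k ≫ g)) :
    ClosedCrible J X Y where
  rel U f g := ∃ S : Sieve U, S ∈ J U ∧ ∀ ⦃V : C⦄ (k : V ⟶ U), S k → K (k ≫ f) (k ≫ g)
  precomp U V k f g := by
    rintro ⟨S, hS, h⟩
    refine ⟨S.pullback k, J.pullback_stable k hS, fun W l hl => ?_⟩
    simpa using h (l ≫ k) hl
  closed U f g S hS h := by
    choose T hT hK' using fun (V : C) (k : V ⟶ U) (hk : S k) => h k hk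
    refine ⟨Sieve.bind S.arrows fun V k hk => T V k hk,
      J.bind_covering hS fun V k hk => hT V k hk, ?_⟩
    rintro V _ ⟨V', k, l, hl, hk, rfl⟩
    simpa using hK' V' l hl k hk

variable {K : ∀ ⦃U : C⦄, (U ⟶ X) → (U ⟶ Y) → Prop}
  {hK : ∀ ⦃U V : C⦄ (k : V ⟶ U) (f : U ⟶ X) (g : U ⟶ Y), K f g → K (k ≫ f) (k ≫ g)}

theorem gen_of {U : C} {f : U ⟶ X} {g : U ⟶ Y} (h : K f g) : (gen J K hK).rel f g :=
  ⟨⊤, J.top_mem U, fun _ k _ => hK k f g h⟩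

theorem gen_le_iff (R : ClosedCrible J X Y) :
    gen J K hK ≤ R ↔ ∀ ⦃U : C⦄ (f : U ⟶ X) (g : U ⟶ Y), K f g → R.rel f g :=
  ⟨fun h _ f g hf => h f g (gen_of hf), fun h _ f g ⟨S, hS, hk⟩ =>
    R.closed f g S hS fun _ k hk' => h _ _ (hk k hk')⟩

/-- The identity: the closure of the set of spans `(f, f)`. -/
def one (J : GrothendieckTopology C) (X : C) : ClosedCrible J X X :=
  gen J (fun _ f g => f = g) fun _ _ k f g h => by rw [h]

/-- The composite: the closure of the set of spans `(f, h)` for which there is a `g` with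
`(f, g) ∈ R` and `(g, h) ∈ S`. -/
def comp (R : ClosedCrible J X Y) (S : ClosedCrible J Y Z) : ClosedCrible J X Z :=
  gen J (fun U f h => ∃ g : U ⟶ Y, R.rel f g ∧ S.rel g h) fun _ _ k _ _ ⟨g, hR, hS⟩ =>
    ⟨k ≫ g, R.precomp k hR, S.precomp k hS⟩

/-- The opposite crible. -/
def op (R : ClosedCrible J X Y) : ClosedCrible J Y X where
  rel _ f g := R.rel g f
  precomp _ _ k _ _ h := R.precomp k h
  closed _ f g S hS h := R.closed g f S hS h

instance : SupSet (ClosedCrible J X Y) where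
  sSup s := gen J (fun _ f g => ∃ R ∈ s, R.rel f g) fun _ _ k _ _ ⟨R, hR, h⟩ =>
    ⟨R, hR, R.precomp k h⟩

theorem isLUB (s : Set (ClosedCrible J X Y)) : IsLUB s (sSup s) :=
  ⟨fun R hR _ _ _ h => gen_of ⟨R, hR, h⟩,
    fun T hT => (gen_le_iff T).2 fun _ f g ⟨_, hR, h⟩ => hT hR f g h⟩

instance lattice : CompleteLattice (ClosedCrible J X Y) :=
  completeLatticeOfSup _ isLUB

theorem comp_le_iff (R : ClosedCrible J X Y) (S : ClosedCrible J Y Z) (T : ClosedCrible J X Z) :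
    comp R S ≤ T ↔ ∀ ⦃U : C⦄ (f : U ⟶ X) (g : U ⟶ Y) (h : U ⟶ Z),
      R.rel f g → S.rel g h → T.rel f h :=
  (gen_le_iff T).trans ⟨fun H _ f g h hR hS => H f h ⟨g, hR, hS⟩,
    fun H _ f h ⟨g, hR, hS⟩ => H f g h hR hS⟩

theorem comp_rel {R : ClosedCrible J X Y} {S : ClosedCrible J Y Z} {U : C} {f : U ⟶ X}
    {g : U ⟶ Y} {h : U ⟶ Z} (hR : R.rel f g) (hS : S.rel g h) : (comp R S).rel f h :=
  gen_of ⟨g, hR, hS⟩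

theorem one_comp (R : ClosedCrible J X Y) : comp (one J X) R = R := by
  refine le_antisymm ((comp_le_iff _ _ _).2 ?_) fun U f g h => comp_rel (gen_of rfl) h
  rintro U f g h ⟨S, hS, hk⟩ hR
  exact R.closed f h S hS fun V k hk' => by rw [hk k hk']; exact R.precomp k hR

theorem comp_one (R : ClosedCrible J X Y) : comp R (one J Y) = R := by
  refine le_antisymm ((comp_le_iff _ _ _).2 ?_) fun U f g h => comp_rel h (gen_of rfl)
  rintro U f g h hR ⟨S, hS, hk⟩
  exact R.closed f h S hS fun V k hk' => by rw [← hk k hk']; exact R.precomp k hR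

theorem comp_assoc (R : ClosedCrible J X Y) (S : ClosedCrible J Y Z) (T : ClosedCrible J Z W) :
    comp (comp R S) T = comp R (comp S T) := by
  apply le_antisymm
  · rw [comp_le_iff]
    rintro U f g h ⟨P, hP, hk⟩ hT
    refine (comp R (comp S T)).closed f h P hP fun V k hk' => ?_
    obtain ⟨l, hR, hS⟩ := hk k hk'
    exact comp_rel hR (comp_rel hS (T.precomp k hT))
  · rw [comp_le_iff]
    rintro U f g h hR ⟨P, hP, hk⟩
    refine (comp (comp R S) T).closed f h P hP fun V k hk' => ?_
    obtain ⟨l, hS, hT⟩ := hk k hk'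
    exact comp_rel (comp_rel (R.precomp k hR) hS) hT

theorem sSup_comp (s : Set (ClosedCrible J X Y)) (S : ClosedCrible J Y Z) :
    comp (sSup s) S = ⨆ R ∈ s, comp R S := by
  refine le_antisymm ((comp_le_iff _ _ _).2 ?_) (iSup₂_le fun R hR =>
    (comp_le_iff _ _ _).2 fun U f g h hf hg => comp_rel ((isLUB s).1 hR f g hf) hg)
  rintro U f g h ⟨P, hP, hk⟩ hS
  refine ClosedCrible.closed _ f h P hP fun V k hk' => ?_
  obtain ⟨R, hR, hf⟩ := hk k hk'
  exact le_iSup₂ (f := fun R (_ : R ∈ s) => comp R S) R hR _ _ (comp_rel hf (S.precomp k hS))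

theorem comp_sSup (R : ClosedCrible J X Y) (s : Set (ClosedCrible J Y Z)) :
    comp R (sSup s) = ⨆ S ∈ s, comp R S := by
  refine le_antisymm ((comp_le_iff _ _ _).2 ?_) (iSup₂_le fun S hS =>
    (comp_le_iff _ _ _).2 fun U f g h hf hg => comp_rel hf ((isLUB s).1 hS g h hg))
  rintro U f g h hR ⟨P, hP, hk⟩
  refine ClosedCrible.closed _ f h P hP fun V k hk' => ?_
  obtain ⟨S, hS, hf⟩ := hk k hk'
  exact le_iSup₂ (f := fun S (_ : S ∈ s) => comp R S) S hS _ _ (comp_rel (R.precomp k hR) hf)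

theorem op_one (J : GrothendieckTopology C) (X : C) : op (one J X) = one J X := by
  ext U f g
  exact exists_congr fun S => and_congr_right fun _ => forall_congr' fun V =>
    forall_congr' fun k => imp_congr_right fun _ => eq_comm

theorem op_comp (R : ClosedCrible J X Y) (S : ClosedCrible J Y Z) :
    op (comp R S) = comp (op S) (op R) := by
  ext U f g
  exact exists_congr fun P => and_congr_right fun _ => forall_congr' fun V =>
    forall_congr' fun k => imp_congr_right fun _ => exists_congr fun _ => and_comm

theorem op_sSup (s : Set (ClosedCrible J X Y)) : op (sSup s) = ⨆ R ∈ s, op R := by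
  refine le_antisymm ?_ (iSup₂_le fun R hR _ f g h => (isLUB s).1 hR g f h)
  rintro U f g ⟨P, hP, hk⟩
  refine ClosedCrible.closed _ f g P hP fun V k hk' => ?_
  obtain ⟨R, hR, hf⟩ := hk k hk'
  exact le_iSup₂ (f := fun R (_ : R ∈ s) => op R) R hR _ _ hf

end ClosedCrible

/-- The objects of the quantaloid of closed cribles `R(C, J)`: those of `C`. -/
def ClosedCribles {C : Type u} [Category.{v} C] (_ : GrothendieckTopology C) : Type u := C

open ClosedCrible in
/-- The involutive quantaloid of closed cribles `R(C, J)` of a site. -/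
instance {C : Type u} [Category.{v} C] (J : GrothendieckTopology C) :
    InvolutiveQuantaloid.{max u v} (ClosedCribles J) where
  Hom X Y := ClosedCrible (C := C) J X Y
  id X := one (C := C) J X
  comp R S := ClosedCrible.comp R S
  id_comp R := one_comp R
  comp_id R := comp_one R
  assoc R S T := comp_assoc R S T
  homLattice X Y := ClosedCrible.lattice (C := C) (J := J) (X := X) (Y := Y)
  sSup_comp s S := ClosedCrible.sSup_comp s S
  comp_sSup R s := ClosedCrible.comp_sSup R s
  invol R := ClosedCrible.op R
  invol_invol _ := rfl
  invol_id X := op_one (C := C) J X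
  invol_comp R S := op_comp R S
  invol_sSup s := op_sSup s

/-- A small involutive quantaloid is a small quantaloid of closed cribles if it is equivalent, as
an involutive quantaloid, to `R(C, J)` for some small site `(C, J)`: there is a fully faithful and
essentially surjective functor that preserves suprema and the involution. -/
def IsQuantaloidOfClosedCribles (Q : Type u) [InvolutiveQuantaloid.{u} Q] : Prop :=
  ∃ (C : Type u) (_ : SmallCategory C) (J : GrothendieckTopology C) (F : Q ⥤ ClosedCribles J),
    F.IsEquivalence ∧
    (∀ {X Y : Q} (s : Set (X ⟶ Y)), F.map (sSup s) = ⨆ f ∈ s, F.map f) ∧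
    ∀ {X Y : Q} (f : X ⟶ Y), F.map (invol f) = invol (F.map f)

/-! ### Splitting the symmetric idempotents -/

/-- The objects of `Q_ssi`: the symmetric idempotents of `Q`. -/
structure Ssi (Q : Type u) [InvolutiveQuantaloid.{v} Q] where
  pt : Q
  e : pt ⟶ pt
  idem : e ≫ e = e
  symm : invol e = e

namespace Ssi

variable {Q : Type u} [InvolutiveQuantaloid.{v} Q]

/-- The morphisms of `Q_ssi`. -/
@[ext]
structure Hom (a b : Ssi Q) where
  val : a.pt ⟶ b.pt
  left : a.e ≫ val = val
  right : val ≫ b.e = val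

instance (a b : Ssi Q) : PartialOrder (Hom a b) :=
  PartialOrder.lift Hom.val fun _ _ => Hom.ext

instance (a b : Ssi Q) : SupSet (Hom a b) where
  sSup s :=
    { val := ⨆ f ∈ s, f.val
      left := by simp only [comp_iSup, Hom.left]
      right := by simp only [iSup_comp, Hom.right] }

theorem isLUB (a b : Ssi Q) (s : Set (Hom a b)) : IsLUB s (sSup s) :=
  ⟨fun f hf => le_iSup₂ (f := fun (f : Hom a b) (_ : f ∈ s) => f.val) f hf,
    fun _ hg => iSup₂_le fun _ hf => hg hf⟩

instance (a b : Ssi Q) : CompleteLattice (Hom a b) :=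
  completeLatticeOfSup _ (isLUB a b)

variable {a b c : Ssi Q}

/-- Composition, as in `Q`. -/
def Hom.comp (f : Hom a b) (g : Hom b c) : Hom a c :=
  ⟨f.val ≫ g.val, by rw [← Category.assoc, f.left], by rw [Category.assoc, g.right]⟩

/-- Involution, as in `Q`. -/
def Hom.inv (f : Hom a b) : Hom b a :=
  ⟨invol f.val, by rw [← b.symm, ← invol_comp, f.right], by rw [← a.symm, ← invol_comp, f.left]⟩

theorem sSup_comp (s : Set (Hom a b)) (g : Hom b c) : (sSup s).comp g = ⨆ f ∈ s, f.comp g := by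
  refine le_antisymm ?_ (iSup₂_le fun f hf => comp_le_comp (Q := Q) ((isLUB a b s).1 hf) le_rfl)
  change (⨆ f ∈ s, f.val) ≫ g.val ≤ (⨆ f ∈ s, f.comp g).val
  simp only [iSup_comp]
  exact iSup₂_le fun f hf => le_iSup₂ (f := fun (f : Hom a b) (_ : f ∈ s) => f.comp g) f hf

theorem comp_sSup (f : Hom a b) (s : Set (Hom b c)) : f.comp (sSup s) = ⨆ g ∈ s, f.comp g := by
  refine le_antisymm ?_ (iSup₂_le fun g hg => comp_le_comp (Q := Q) le_rfl ((isLUB b c s).1 hg))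
  change f.val ≫ (⨆ g ∈ s, g.val) ≤ (⨆ g ∈ s, f.comp g).val
  simp only [comp_iSup]
  exact iSup₂_le fun g hg => le_iSup₂ (f := fun (g : Hom b c) (_ : g ∈ s) => f.comp g) g hg

theorem inv_sSup (s : Set (Hom a b)) : (sSup s).inv = ⨆ f ∈ s, f.inv := by
  refine le_antisymm ?_ (iSup₂_le fun f hf => invol_mono (Q := Q) ((isLUB a b s).1 hf))
  change invol (⨆ f ∈ s, f.val) ≤ (⨆ f ∈ s, f.inv).val
  rw [← sSup_image, invol_sSup, iSup_image]
  exact iSup₂_le fun f hf => le_iSup₂ (f := fun (f : Hom a b) (_ : f ∈ s) => f.inv) f hf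

/-- The quantaloid `Q_ssi`: composition, suprema and involution are as in `Q`, and the identity of
`e` is `e` itself. -/
instance : InvolutiveQuantaloid.{v} (Ssi Q) where
  Hom a b := Hom a b
  id a := ⟨a.e, a.idem, a.idem⟩
  comp f g := f.comp g
  id_comp f := Hom.ext f.left
  comp_id f := Hom.ext f.right
  assoc _ _ _ := Hom.ext (Category.assoc _ _ _)
  homLattice a b := inferInstanceAs (CompleteLattice (Hom a b))
  sSup_comp s g := sSup_comp s g
  comp_sSup f s := comp_sSup f s
  invol f := f.inv
  invol_invol _ := Hom.ext (invol_invol _)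
  invol_id a := Hom.ext a.symm
  invol_comp _ _ := Hom.ext (invol_comp _ _)
  invol_sSup s := inv_sSup s

end Ssi

/-! ### Enriched categories, functors and distributors -/

/-- A (small) category enriched in a quantaloid. The typed set of objects is given by its fibres:
`A.obj X` is the set of objects of type `X`. The hom-arrow `A(y, x) : X ⟶ Y`, for `x` of type `X`
and `y` of type `Y`, is `A.hom y x`. -/
structure QCat (Q : Type u) [Quantaloid.{u} Q] where
  obj : Q → Type u
  hom : ∀ {X Y : Q}, obj Y → obj X → (X ⟶ Y)
  id_le : ∀ {X : Q} (x : obj X), 𝟙 X ≤ hom x x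
  comp_le : ∀ {X Y Z : Q} (x : obj X) (y : obj Y) (z : obj Z), hom y x ≫ hom z y ≤ hom z x

namespace QCat

variable {Q : Type u} [Quantaloid.{u} Q]

/-- A type-preserving functor. -/
@[ext]
structure Functor (A B : QCat Q) where
  map : ∀ {X : Q}, A.obj X → B.obj X
  hom_le : ∀ {X Y : Q} (x : A.obj X) (y : A.obj Y), A.hom y x ≤ B.hom (map y) (map x)

/-- The locally ordered category `Cat(Q)`; `F ≤ G` when `1 ≤ B(Fx, Gx)` for every object `x`. -/
instance : LocallyOrdered.{u} (QCat Q) where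
  Hom A B := Functor A B
  id A := ⟨fun x => x, fun _ _ => le_rfl⟩
  comp F G := ⟨fun x => G.map (F.map x), fun x y => (F.hom_le x y).trans (G.hom_le _ _)⟩
  homPreorder A B :=
    { le := fun F G => ∀ ⦃X : Q⦄ (x : A.obj X), 𝟙 X ≤ B.hom (F.map x) (G.map x)
      le_refl := fun F _ x => B.id_le (F.map x)
      le_trans := fun F G H h h' _ x => by
        have := (comp_le_comp (h' x) (h x)).trans (B.comp_le (H.map x) (G.map x) (F.map x))
        simpa using this }
  comp_mono {A B C F F' G G'} h h' X x := by
    have h1 : 𝟙 X ≤ C.hom (G.map (F.map x)) (G.map (F'.map x)) := (h x).trans (G.hom_le _ _)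
    have := (comp_le_comp (h' (F'.map x)) h1).trans (C.comp_le _ _ _)
    simpa using this

/-- A distributor `Φ : A → B`, with elements `Φ(y, x) : X ⟶ Y` for `x` in `A` of type `X` and `y`
in `B` of type `Y`. -/
@[ext]
structure Distributor (A B : QCat Q) where
  app : ∀ {X Y : Q}, B.obj Y → A.obj X → (X ⟶ Y)
  app_comp_le : ∀ {X Y Y' : Q} (x : A.obj X) (y : B.obj Y) (y' : B.obj Y'),
    app y x ≫ B.hom y' y ≤ app y' x
  comp_app_le : ∀ {X X' Y : Q} (x : A.obj X) (x' : A.obj X') (y : B.obj Y),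
    A.hom x x' ≫ app y x ≤ app y x'

namespace Distributor

variable {A B C D : QCat Q}

instance : PartialOrder (Distributor A B) where
  le Φ Ψ := ∀ ⦃X Y : Q⦄ (x : A.obj X) (y : B.obj Y), Φ.app y x ≤ Ψ.app y x
  le_refl _ _ _ _ _ := le_rfl
  le_trans _ _ _ h h' _ _ x y := (h x y).trans (h' x y)
  le_antisymm Φ Ψ h h' := by
    ext X Y y x
    exact le_antisymm (h x y) (h' x y)

instance : SupSet (Distributor A B) where
  sSup s :=
    { app := fun y x => ⨆ Φ ∈ s, Φ.app y x
      app_comp_le := fun x y y' => by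
        simp only [iSup_comp]
        exact iSup₂_mono fun Φ _ => Φ.app_comp_le x y y'
      comp_app_le := fun x x' y => by
        simp only [comp_iSup]
        exact iSup₂_mono fun Φ _ => Φ.comp_app_le x x' y }

theorem isLUB (s : Set (Distributor A B)) : IsLUB s (sSup s) :=
  ⟨fun Φ hΦ _ _ x y => le_iSup₂ (f := fun (Φ : Distributor A B) (_ : Φ ∈ s) => Φ.app y x) Φ hΦ,
    fun _ hΨ _ _ x y => iSup₂_le fun _ hΦ => hΨ hΦ x y⟩

instance lattice : CompleteLattice (Distributor A B) :=
  completeLatticeOfSup _ isLUB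

/-- The identity distributor. -/
def one (A : QCat Q) : Distributor A A where
  app y x := A.hom y x
  app_comp_le x y y' := A.comp_le x y y'
  comp_app_le x x' y := A.comp_le x' x y

/-- The composite distributor, first `Φ` and then `Ψ`: its element at `(z, x)` is the supremum of
the `Ψ(z, y) ∘ Φ(y, x)` over all objects `y` of `B`. -/
def comp (Φ : Distributor A B) (Ψ : Distributor B C) : Distributor A C where
  app z x := ⨆ (Y : Q) (y : B.obj Y), Φ.app y x ≫ Ψ.app z y
  app_comp_le x z z' := by
    simp only [iSup_comp, Category.assoc]
    exact iSup₂_mono fun Y y => comp_le_comp le_rfl (Ψ.app_comp_le y z z')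
  comp_app_le x x' z := by
    simp only [comp_iSup, ← Category.assoc]
    exact iSup₂_mono fun Y y => comp_le_comp (Φ.comp_app_le x x' y) le_rfl

theorem le_comp_app (Φ : Distributor A B) (Ψ : Distributor B C) {X Y Z : Q} (x : A.obj X)
    (y : B.obj Y) (z : C.obj Z) : Φ.app y x ≫ Ψ.app z y ≤ (comp Φ Ψ).app z x :=
  le_iSup₂ (f := fun (Y : Q) (y : B.obj Y) => Φ.app y x ≫ Ψ.app z y) Y y

theorem comp_le_iff (Φ : Distributor A B) (Ψ : Distributor B C) (Θ : Distributor A C) :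
    comp Φ Ψ ≤ Θ ↔ ∀ {X Y Z : Q} (x : A.obj X) (y : B.obj Y) (z : C.obj Z),
      Φ.app y x ≫ Ψ.app z y ≤ Θ.app z x :=
  ⟨fun h _ _ _ x y z => (le_comp_app Φ Ψ x y z).trans (h x z),
    fun h _ _ x z => iSup₂_le fun _ y => h x y z⟩

theorem one_comp (Φ : Distributor A B) : comp (one A) Φ = Φ := by
  refine le_antisymm ((comp_le_iff (one A) Φ Φ).2 fun x y z => Φ.comp_app_le y x z) ?_
  intro X Z x z
  refine le_trans ?_ (le_comp_app (one A) Φ x x z)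
  change _ ≤ A.hom x x ≫ Φ.app z x
  simpa using comp_le_comp (A.id_le x) (le_refl (Φ.app z x))

theorem comp_one (Φ : Distributor A B) : comp Φ (one B) = Φ := by
  refine le_antisymm ((comp_le_iff Φ (one B) Φ).2 fun x y z => Φ.app_comp_le x y z) ?_
  intro X Z x z
  refine le_trans ?_ (le_comp_app Φ (one B) x z z)
  change _ ≤ Φ.app z x ≫ B.hom z z
  simpa using comp_le_comp (le_refl (Φ.app z x)) (B.id_le z)

theorem comp_assoc (Φ : Distributor A B) (Ψ : Distributor B C) (Θ : Distributor C D) :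
    comp (comp Φ Ψ) Θ = comp Φ (comp Ψ Θ) := by
  apply le_antisymm
  · rw [comp_le_iff]
    intro X Z W x z w
    change (⨆ (Y : Q) (y : B.obj Y), Φ.app y x ≫ Ψ.app z y) ≫ Θ.app w z ≤ _
    simp only [iSup_comp, Category.assoc]
    exact iSup₂_le fun Y y => (comp_le_comp le_rfl (le_comp_app Ψ Θ y z w)).trans
      (le_comp_app Φ (comp Ψ Θ) x y w)
  · rw [comp_le_iff]
    intro X Y W x y w
    change Φ.app y x ≫ (⨆ (Z : Q) (z : C.obj Z), Ψ.app z y ≫ Θ.app w z) ≤ _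
    simp only [comp_iSup, ← Category.assoc]
    exact iSup₂_le fun Z z => (comp_le_comp (le_comp_app Φ Ψ x y z) le_rfl).trans
      (le_comp_app (comp Φ Ψ) Θ x z w)

theorem sSup_comp (s : Set (Distributor A B)) (Ψ : Distributor B C) :
    comp (sSup s) Ψ = ⨆ Φ ∈ s, comp Φ Ψ := by
  refine le_antisymm ((comp_le_iff (sSup s) Ψ _).2 fun x y z => ?_) (iSup₂_le fun Φ hΦ =>
    (comp_le_iff Φ Ψ _).2 fun x y z =>
      (comp_le_comp ((isLUB s).1 hΦ x y) le_rfl).trans (le_comp_app _ _ x y z))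
  change (⨆ Φ ∈ s, Φ.app y x) ≫ Ψ.app z y ≤ _
  simp only [iSup_comp]
  exact iSup₂_le fun Φ hΦ => (le_comp_app Φ Ψ x y z).trans
    (le_iSup₂ (f := fun Φ (_ : Φ ∈ s) => comp Φ Ψ) Φ hΦ x z)

theorem comp_sSup (Φ : Distributor A B) (s : Set (Distributor B C)) :
    comp Φ (sSup s) = ⨆ Ψ ∈ s, comp Φ Ψ := by
  refine le_antisymm ((comp_le_iff Φ (sSup s) _).2 fun x y z => ?_) (iSup₂_le fun Ψ hΨ =>
    (comp_le_iff Φ Ψ _).2 fun x y z =>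
      (comp_le_comp le_rfl ((isLUB s).1 hΨ y z)).trans (le_comp_app _ _ x y z))
  change Φ.app y x ≫ (⨆ Ψ ∈ s, Ψ.app z y) ≤ _
  simp only [comp_iSup]
  exact iSup₂_le fun Ψ hΨ => (le_comp_app Φ Ψ x y z).trans
    (le_iSup₂ (f := fun Ψ (_ : Ψ ∈ s) => comp Φ Ψ) Ψ hΨ x z)

/-- The distributor `B(-, F-)` represented by a functor `F : A → B`. -/
def ofFunctor (F : A ⟶ B) : Distributor A B where
  app y x := B.hom y (Functor.map F x)
  app_comp_le _ y y' := B.comp_le _ y y'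
  comp_app_le x x' y := (comp_le_comp (Functor.hom_le F x' x) le_rfl).trans (B.comp_le _ _ y)

end Distributor

end QCat

/-- The category `Dist(Q)`: its objects are the `Q`-categories. -/
def DistQ (Q : Type u) [Quantaloid.{u} Q] : Type (u + 1) := QCat Q

open QCat QCat.Distributor in
/-- The quantaloid `Dist(Q)` of `Q`-categories and distributors. -/
instance {Q : Type u} [Quantaloid.{u} Q] : Quantaloid.{u} (DistQ Q) where
  Hom A B := Distributor (Q := Q) A B
  id A := one (Q := Q) A
  comp Φ Ψ := Distributor.comp Φ Ψ
  id_comp Φ := one_comp Φ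
  comp_id Φ := comp_one Φ
  assoc Φ Ψ Θ := comp_assoc Φ Ψ Θ
  homLattice A B := Distributor.lattice (Q := Q) (A := A) (B := B)
  sSup_comp s Ψ := Distributor.sSup_comp s Ψ
  comp_sSup Φ s := Distributor.comp_sSup Φ s

/-! ### Symmetry and completeness -/

namespace QCat

/-- A `Q`-category is Cauchy complete when every left adjoint distributor into it is represented
by a functor. -/
def IsCauchyComplete {Q : Type u} [Quantaloid.{u} Q] : ObjectProperty (QCat Q) :=
  fun A => ∀ (B : QCat Q) (Φ : Distributor B A),
    IsLeftAdjoint (Q := DistQ Q) (X := B) (Y := A) Φ → ∃ F : B ⟶ A, Φ = Distributor.ofFunctor F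

variable {Q : Type u} [InvolutiveQuantaloid.{u} Q]

def IsSymmetric (A : QCat Q) : Prop :=
  ∀ {X Y : Q} (x : A.obj X) (y : A.obj Y), A.hom x y = invol (A.hom y x)

/-- The involute `Φ°` of a distributor between symmetric categories: `Φ°(a, b) = Φ(b, a)°`. -/
def Distributor.involute {A B : QCat Q} (hA : A.IsSymmetric) (hB : B.IsSymmetric)
    (Φ : Distributor A B) : Distributor B A where
  app a b := invol (Φ.app b a)
  app_comp_le b a a' := by
    rw [hA a' a, ← invol_comp]
    exact invol_mono (Φ.comp_app_le a a' b)
  comp_app_le b b' a := by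
    rw [hB b b', ← invol_comp]
    exact invol_mono (Φ.app_comp_le a b b')

/-- A symmetric `Q`-category is symmetrically complete when every symmetric left adjoint
distributor (one whose right adjoint is its involute) from a symmetric `Q`-category into it is
represented by a functor. -/
def IsSymmetricallyComplete (A : QCat Q) (hA : A.IsSymmetric) : Prop :=
  ∀ (B : QCat Q) (hB : B.IsSymmetric) (Φ : Distributor B A),
    Adj (Q := DistQ Q) (X := B) (Y := A) Φ (Φ.involute hB hA) →
      ∃ F : B ⟶ A, Φ = Distributor.ofFunctor F

/-- Symmetric and symmetrically complete. -/
def IsSymComplete : ObjectProperty (QCat Q) :=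
  fun A => ∃ hA : A.IsSymmetric, A.IsSymmetricallyComplete hA

end QCat

/-- `Cat_cc(Q)`: Cauchy complete `Q`-categories and functors. -/
abbrev CatCC (Q : Type u) [Quantaloid.{u} Q] : Type (u + 1) :=
  (QCat.IsCauchyComplete (Q := Q)).FullSubcategory

/-- The objects of `Dist(Q)` that are Cauchy complete. -/
def distIsCC (Q : Type u) [Quantaloid.{u} Q] : ObjectProperty (DistQ Q) :=
  fun A => QCat.IsCauchyComplete (Q := Q) A

/-- `Dist_cc(Q)`: Cauchy complete `Q`-categories and distributors. -/
abbrev DistCC (Q : Type u) [Quantaloid.{u} Q] : Type (u + 1) :=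
  (distIsCC Q).FullSubcategory

/-- The objects of `Dist(Q)` that are symmetric and symmetrically complete. -/
def distIsSC (Q : Type u) [InvolutiveQuantaloid.{u} Q] : ObjectProperty (DistQ Q) :=
  fun A => QCat.IsSymComplete (Q := Q) A

/-- `Sh(Q)`: the full subcategory of `Cat(Q_ssi)` on the symmetric, symmetrically complete
categories. -/
abbrev Sh (Q : Type u) [InvolutiveQuantaloid.{u} Q] : Type (u + 1) :=
  (QCat.IsSymComplete (Q := Ssi Q)).FullSubcategory

/-- `Rel(Q)`: the full subquantaloid of `Dist(Q_ssi)` on the symmetric, symmetrically complete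
categories. -/
abbrev RelQ (Q : Type u) [InvolutiveQuantaloid.{u} Q] : Type (u + 1) :=
  (distIsSC (Ssi Q)).FullSubcategory

/-- The orders and order functions over the symmetric idempotents of `Q`: `Cat_cc(Q_ssi)`. -/
abbrev OrdSsi (Q : Type u) [InvolutiveQuantaloid.{u} Q] : Type (u + 1) :=
  CatCC (Ssi Q)

/-- The orders and ideal relations over the symmetric idempotents of `Q`: `Dist_cc(Q_ssi)`. -/
abbrev IdlSsi (Q : Type u) [InvolutiveQuantaloid.{u} Q] : Type (u + 1) :=
  DistCC (Ssi Q)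

/-- `Ord` and `Idl` have the same objects. -/
def IdlSsi.toOrd {Q : Type u} [InvolutiveQuantaloid.{u} Q] (D : IdlSsi Q) : OrdSsi Q :=
  ⟨D.obj, D.property⟩

-- The argument isolates two properties of an involutive quantaloid, with "map" meaning an arrow
-- left adjoint to its involute. Weak tabularity: every arrow is determined by the composites `f° ≫
-- g` of maps lying below it. Bilaterality: a cover `𝟙 ≤ ⨆ f i ≫ g i` can be refined to `𝟙 ≤ ⨆ h i ≫
-- (h i)°` with `h i` below both `f i` and `(g i)°`.
--
-- Symmetric categories are always discrete: apply the involution to `𝟙 ≤ A(a, b)`. Conversely,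
-- objects of a Cauchy complete `A` can be restricted along left adjoints, so for maps `f`, `g` the
-- inequality `f° ≫ g ≤ A(y, x)` is an inequality between the objects `x · f` and `y · g`.
-- Discreteness reverses it, giving `f° ≫ g ≤ A(x, y)°`, and weak tabularity concludes
-- (`isSymmetric_of_isDiscreteObj`).
--
-- Bilaterality forces the right adjoint of a left adjoint distributor into a symmetric category to
-- be its involute (`eq_invol_of_adjTo`). Symmetric completeness therefore gives Cauchy completeness
-- once the domain is symmetric. An arbitrary domain is handled one object at a time, through the
-- category of left adjoints into the type of that object.
--
-- For closed cribles, weak tabularity holds because a crible is a set of spans, and bilaterality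
-- because `h i` can be the intersection of `f i` and `(g i)°`. Bilaterality is verified directly
-- after splitting the symmetric idempotents and then restricted to the quantaloid itself. Weak
-- tabularity goes the other way, and its lifting uses bilaterality.

universe w

/-! ### Maps and bilaterality in involutive quantaloids -/

namespace Quantaloid

variable {Q : Type u} [Quantaloid.{v} Q] {X Y Z : Q}

theorem comp_le_left {f f' : X ⟶ Y} (g : Y ⟶ Z) (h : f ≤ f') : f ≫ g ≤ f' ≫ g :=
  comp_le_comp h le_rfl

theorem comp_le_right (f : X ⟶ Y) {g g' : Y ⟶ Z} (h : g ≤ g') : f ≫ g ≤ f ≫ g' :=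
  comp_le_comp le_rfl h

theorem le_comp_of_one_le {f : X ⟶ X} (h : 𝟙 X ≤ f) (g : X ⟶ Y) : g ≤ f ≫ g := by
  simpa using comp_le_left g h

theorem le_comp_of_one_le' {f : Y ⟶ Y} (h : 𝟙 Y ≤ f) (g : X ⟶ Y) : g ≤ g ≫ f := by
  simpa using comp_le_right g h

theorem comp_le_of_le_one {f : X ⟶ X} (h : f ≤ 𝟙 X) (g : X ⟶ Y) : f ≫ g ≤ g := by
  simpa using comp_le_left g h

theorem comp_le_of_le_one' {f : Y ⟶ Y} (h : f ≤ 𝟙 Y) (g : X ⟶ Y) : g ≫ f ≤ g := by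
  simpa using comp_le_right g h

theorem adj_id (X : Q) : Adj (𝟙 X) (𝟙 X) := by
  simp [Adj]

theorem Adj.comp {f : X ⟶ Y} {f' : Y ⟶ X} {g : Y ⟶ Z} {g' : Z ⟶ Y} (hf : Adj f f')
    (hg : Adj g g') : Adj (f ≫ g) (g' ≫ f') := by
  constructor
  · simpa using hf.1.trans (comp_le_right f (le_comp_of_one_le hg.1 f'))
  · simpa using (comp_le_right g' (comp_le_of_le_one hf.2 g)).trans hg.2

end Quantaloid

namespace InvolutiveQuantaloid

variable {Q : Type u} [InvolutiveQuantaloid.{v} Q] {X Y Z : Q}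

theorem invol_le_invol_iff {f g : X ⟶ Y} : invol f ≤ invol g ↔ f ≤ g :=
  ⟨fun h => by simpa only [invol_invol] using invol_mono h, invol_mono⟩

theorem invol_le_iff {f : X ⟶ Y} {g : Y ⟶ X} : invol f ≤ g ↔ f ≤ invol g := by
  rw [← invol_le_invol_iff, invol_invol]

/-- A map: an arrow that is left adjoint to its involute. -/
def IsMap (f : X ⟶ Y) : Prop :=
  Adj f (invol f)

theorem IsMap.comp {f : X ⟶ Y} {g : Y ⟶ Z} (hf : IsMap f) (hg : IsMap g) : IsMap (f ≫ g) := by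
  rw [IsMap, invol_comp]
  exact Adj.comp hf hg

variable (Q) in
/-- Every arrow is the supremum of the arrows `f° ≫ g` below it, with `f` and `g` maps. -/
def IsWeaklyTabular : Prop :=
  ∀ ⦃X Y : Q⦄ (q t : X ⟶ Y), (∀ ⦃U : Q⦄ (f : U ⟶ X) (g : U ⟶ Y), IsMap f → IsMap g →
    invol f ≫ g ≤ q → invol f ≫ g ≤ t) → q ≤ t

variable (Q) in
/-- Every cover of an identity by composites can be refined to a symmetric one. -/
def IsBilateral : Prop :=
  ∀ ⦃ι : Type v⦄ ⦃X : Q⦄ (Y : ι → Q) (f : ∀ i, X ⟶ Y i) (g : ∀ i, Y i ⟶ X),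
    𝟙 X ≤ ⨆ i, f i ≫ g i →
      ∃ h : ∀ i, X ⟶ Y i, (∀ i, h i ≤ f i) ∧ (∀ i, h i ≤ invol (g i)) ∧
        𝟙 X ≤ ⨆ i, h i ≫ invol (h i)

theorem IsBilateral.one_le (hQ : IsBilateral Q) {f : X ⟶ Y} {g : Y ⟶ X} (h : 𝟙 X ≤ f ≫ g) :
    ∃ k : X ⟶ Y, k ≤ f ∧ k ≤ invol g ∧ 𝟙 X ≤ k ≫ invol k := by
  obtain ⟨k, h1, h2, h3⟩ := hQ (ι := PUnit) (fun _ => Y) (fun _ => f) (fun _ => g)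
    (h.trans (le_iSup (fun _ : PUnit => f ≫ g) ⟨⟩))
  exact ⟨k ⟨⟩, h1 _, h2 _, h3.trans (iSup_le fun _ => le_rfl)⟩

/-- A right adjoint is the involute of its left adjoint. -/
theorem IsBilateral.eq_invol (hQ : IsBilateral Q) {f : X ⟶ Y} {g : Y ⟶ X} (h : Adj f g) :
    g = invol f := by
  obtain ⟨k, h1, h2, h3⟩ := hQ.one_le h.1
  have h4 : invol k ≤ g := invol_le_iff.2 h2
  have hk : f ≤ k := by
    -- `f ≤ k ≫ k° ≫ f ≤ k ≫ g ≫ f ≤ k`, so `k` is `f` itself.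
    refine (le_comp_of_one_le h3 f).trans ?_
    rw [Category.assoc]
    exact comp_le_of_le_one' ((comp_le_left f h4).trans h.2) k
  refine le_antisymm ?_ ((invol_mono hk).trans h4)
  refine (le_comp_of_one_le' h3 g).trans ?_
  rw [← Category.assoc]
  exact (comp_le_of_le_one ((comp_le_right g h1).trans h.2) _).trans (invol_mono h1)

end InvolutiveQuantaloid

/-! ### Transport along homomorphisms -/

section Transport

variable {Q : Type u} [InvolutiveQuantaloid.{v} Q] {R : Type w} [InvolutiveQuantaloid.{v} R]

/-- A functor between involutive quantaloids that preserves suprema and the involution. -/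
structure IsQuantaloidHom (F : Q ⥤ R) : Prop where
  map_sSup : ∀ {X Y : Q} (s : Set (X ⟶ Y)), F.map (sSup s) = ⨆ f ∈ s, F.map f
  map_invol : ∀ {X Y : Q} (f : X ⟶ Y), F.map (invol f) = invol (F.map f)

namespace IsQuantaloidHom

variable {F : Q ⥤ R} (hF : IsQuantaloidHom F)
include hF

theorem map_iSup {X Y : Q} {ι : Sort*} (f : ι → (X ⟶ Y)) :
    F.map (⨆ i, f i) = ⨆ i, F.map (f i) := by
  rw [iSup, hF.map_sSup, iSup_range]

theorem map_le_iff [F.Faithful] {X Y : Q} {f g : X ⟶ Y} : F.map f ≤ F.map g ↔ f ≤ g := by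
  have h := hF.map_sSup {f, g}
  rw [iSup_pair, sSup_pair] at h
  constructor
  · intro h'
    rw [sup_eq_right.2 h'] at h
    exact sup_eq_right.1 (F.map_injective h)
  · intro h'
    rw [sup_eq_right.2 h'] at h
    exact sup_eq_right.1 h.symm

theorem isBilateral [F.Full] [F.Faithful] (hR : IsBilateral R) : IsBilateral Q := by
  intro ι X Y f g h
  obtain ⟨k, h1, h2, h3⟩ := hR (fun i => F.obj (Y i)) (fun i => F.map (f i))
    (fun i => F.map (g i)) (by
      rw [← hF.map_le_iff, hF.map_iSup] at h
      simpa using h)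
  refine ⟨fun i => F.preimage (k i), fun i => ?_, fun i => ?_, ?_⟩
  · rw [← hF.map_le_iff]
    simpa using h1 i
  · rw [← hF.map_le_iff, hF.map_invol]
    simpa using h2 i
  · rw [← hF.map_le_iff, hF.map_iSup]
    simpa [hF.map_invol] using h3

theorem isMap_iff [F.Faithful] {X Y : Q} (f : X ⟶ Y) : IsMap (F.map f) ↔ IsMap f := by
  simp only [IsMap, Adj, ← hF.map_invol, ← F.map_comp, ← F.map_id, hF.map_le_iff]

/-- Test maps in `R` start at arbitrary objects and must be moved to objects in the image of `F`.
The isomorphism used for this has to be a map, which an involution alone does not guarantee;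
bilaterality does. -/
theorem isWeaklyTabular [F.IsEquivalence] (hb : IsBilateral R) (hR : IsWeaklyTabular R) :
    IsWeaklyTabular Q := by
  intro X Y q t h
  rw [← hF.map_le_iff]
  refine hR _ _ fun U f g hf hg hq => ?_
  let i := F.objObjPreimageIso U
  have hadj : Adj i.hom i.inv := by simp [Adj]
  have hi : i.inv = invol i.hom := hb.eq_invol hadj
  have him : IsMap i.hom := by rwa [IsMap, ← hi]
  have key : F.map (invol (F.preimage (i.hom ≫ f)) ≫ F.preimage (i.hom ≫ g)) = invol f ≫ g := by
    simp [hF.map_invol, invol_comp, ← hi]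
  rw [← key, hF.map_le_iff]
  refine h _ _ ?_ ?_ ?_
  · rw [← hF.isMap_iff, F.map_preimage]
    exact him.comp hf
  · rw [← hF.isMap_iff, F.map_preimage]
    exact him.comp hg
  · rwa [← hF.map_le_iff, key]

end IsQuantaloidHom

end Transport

/-! ### Splitting symmetric idempotents -/

namespace Ssi

section

variable {Q : Type u} [InvolutiveQuantaloid.{v} Q]

theorem le_iff {a b : Ssi Q} {f g : a ⟶ b} : f ≤ g ↔ f.val ≤ g.val := Iff.rfl

theorem val_sSup {a b : Ssi Q} (s : Set (a ⟶ b)) : (sSup s).val = ⨆ f ∈ s, f.val := rfl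

theorem val_iSup {a b : Ssi Q} {ι : Sort*} (f : ι → (a ⟶ b)) :
    (⨆ i, f i).val = ⨆ i, (f i).val := by
  rw [iSup, val_sSup, iSup_range]

/-- The trivial symmetric idempotents. -/
abbrev ofObj (X : Q) : Ssi Q := ⟨X, 𝟙 X, by simp, invol_id X⟩

/-- The embedding of `Q` into `Q_ssi`. -/
def embedding (Q : Type u) [InvolutiveQuantaloid.{v} Q] : Q ⥤ Ssi Q where
  obj := ofObj
  map f := ⟨f, Category.id_comp f, Category.comp_id f⟩
  map_id _ := rfl
  map_comp _ _ := rfl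

instance : (embedding Q).Full := ⟨fun f => ⟨f.val, rfl⟩⟩

instance : (embedding Q).Faithful := ⟨fun h => congrArg Hom.val h⟩

theorem isQuantaloidHom_embedding : IsQuantaloidHom (embedding Q) where
  map_sSup s := Hom.ext <| by
    change sSup s = _
    simp only [val_iSup, sSup_eq_iSup]
    rfl
  map_invol _ := rfl

variable {R : Type w} [InvolutiveQuantaloid.{v} R] {F : Q ⥤ R} (hF : IsQuantaloidHom F)

/-- The functor between the splittings of the symmetric idempotents induced by a homomorphism. -/
def mapFunctor : Ssi Q ⥤ Ssi R where
  obj a := ⟨F.obj a.pt, F.map a.e, by rw [← F.map_comp, a.idem], by rw [← hF.map_invol, a.symm]⟩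
  map f := ⟨F.map f.val, (F.map_comp _ _).symm.trans (congrArg F.map f.left),
    (F.map_comp _ _).symm.trans (congrArg F.map f.right)⟩
  map_id _ := rfl
  map_comp f g := Hom.ext (F.map_comp f.val g.val)

instance [F.Faithful] : (mapFunctor hF).Faithful :=
  ⟨fun h => Hom.ext (F.map_injective (congrArg Hom.val h))⟩

instance [F.Full] [F.Faithful] : (mapFunctor hF).Full where
  map_surjective {a b} f := by
    obtain ⟨f', hf'⟩ := F.map_surjective (X := a.pt) (Y := b.pt) f.val
    refine ⟨⟨f', F.map_injective ?_, F.map_injective ?_⟩, Hom.ext hf'⟩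
    · rw [F.map_comp, hf']
      exact f.left
    · rw [F.map_comp, hf']
      exact f.right

theorem isQuantaloidHom_mapFunctor : IsQuantaloidHom (mapFunctor hF) where
  map_sSup s := Hom.ext <| by
    change F.map (⨆ f ∈ s, f.val) = _
    simp only [val_iSup, hF.map_iSup]
    rfl
  map_invol _ := Hom.ext (hF.map_invol _)

end

/-! ### Weak tabularity of the split symmetric idempotents -/

section

variable {Q : Type u} [InvolutiveQuantaloid.{v} Q]

/-- If a map `f` lies in the domain of an arrow out of a symmetric idempotent `e`, then it lies in
the extent of `e`. -/
theorem one_le_of_isMap (hb : IsBilateral Q) {a : Ssi Q} {U Y : Q} {f : U ⟶ a.pt} {g : U ⟶ Y}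
    {q : a.pt ⟶ Y} (hf : IsMap f) (hg : IsMap g) (hl : a.e ≫ q = q) (h : invol f ≫ g ≤ q) :
    𝟙 U ≤ f ≫ a.e ≫ invol f := by
  have h1 : g ≤ f ≫ a.e ≫ q := by
    rw [hl]
    refine (le_comp_of_one_le hf.1 g).trans ?_
    rw [Category.assoc]
    exact comp_le_right f h
  have h2 : 𝟙 U ≤ (f ≫ a.e) ≫ (q ≫ invol g) := by
    refine hg.1.trans ((comp_le_left _ h1).trans (le_of_eq ?_))
    simp
  -- Only the bound `k ≤ f ≫ e` matters: it gives `𝟙 ≤ k ≫ k° ≤ f ≫ e ≫ e° ≫ f° = f ≫ e ≫ f°`.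
  obtain ⟨k, hk, -, hk'⟩ := hb.one_le h2
  refine hk'.trans ((comp_le_comp hk (invol_mono hk)).trans (le_of_eq ?_))
  rw [invol_comp, a.symm, Category.assoc, ← Category.assoc a.e, a.idem]

/-- The arrow into a symmetric idempotent given by a map into its underlying object. -/
def homOfMap (a : Ssi Q) {U : Q} (f : U ⟶ a.pt) : ofObj U ⟶ a :=
  ⟨f ≫ a.e, Category.id_comp _, (Category.assoc _ _ _).trans (congrArg (f ≫ ·) a.idem)⟩

theorem isMap_homOfMap {a : Ssi Q} {U : Q} {f : U ⟶ a.pt} (hf : IsMap f)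
    (h : 𝟙 U ≤ f ≫ a.e ≫ invol f) : IsMap (homOfMap a f) := by
  constructor
  · change 𝟙 U ≤ (f ≫ a.e) ≫ invol (f ≫ a.e)
    rw [invol_comp, a.symm, Category.assoc, ← Category.assoc a.e, a.idem]
    exact h
  · change invol (f ≫ a.e) ≫ f ≫ a.e ≤ a.e
    rw [invol_comp, a.symm, Category.assoc, ← Category.assoc (invol f)]
    exact (comp_le_right _ (comp_le_of_le_one hf.2 _)).trans a.idem.le

/-- Since `f° ≤ f° ≫ f ≫ e ≫ f° ≤ e ≫ f°`, a map in the extent of `e` loses nothing when composed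
with `e`. This recovers a test composite in `Q` from its counterpart in `Ssi Q`. -/
theorem invol_le_of_isMap {a : Ssi Q} {U : Q} {f : U ⟶ a.pt} (hf : IsMap f)
    (h : 𝟙 U ≤ f ≫ a.e ≫ invol f) : invol f ≤ a.e ≫ invol f := by
  refine (le_comp_of_one_le' h (invol f)).trans ?_
  rw [← Category.assoc]
  exact comp_le_of_le_one hf.2 _

theorem isWeaklyTabular (hb : IsBilateral Q) (ht : IsWeaklyTabular Q) :
    IsWeaklyTabular (Ssi Q) := by
  intro a b q t H
  rw [le_iff]
  refine ht _ _ fun U f g hf hg hq => ?_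
  have hf1 := one_le_of_isMap hb hf hg q.left hq
  have hg1 : 𝟙 U ≤ g ≫ b.e ≫ invol g := by
    refine one_le_of_isMap hb (q := invol q.val) hg hf ?_ ?_
    · rw [← b.symm, ← invol_comp, q.right]
    · simpa [invol_comp, invol_invol] using invol_mono hq
  -- Sandwiching between the idempotents keeps the composite below `q`, because `q` absorbs them; it
  -- also does not decrease `f° ≫ g`, because both maps lie in the extents.
  have hval : (invol (homOfMap a f) ≫ homOfMap b g).val = a.e ≫ (invol f ≫ g) ≫ b.e := by
    change invol (f ≫ a.e) ≫ g ≫ b.e = _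
    simp [invol_comp, a.symm]
  have h1 := H (homOfMap a f) (homOfMap b g) (isMap_homOfMap hf hf1) (isMap_homOfMap hg hg1) (by
    rw [le_iff, hval]
    refine (comp_le_right _ (comp_le_left _ hq)).trans (le_of_eq ?_)
    rw [q.right, q.left])
  rw [le_iff, hval] at h1
  refine le_trans ?_ h1
  have hg2 : g ≤ g ≫ b.e := by
    simpa [invol_comp, invol_invol, b.symm] using invol_mono (invol_le_of_isMap hg hg1)
  simpa using comp_le_comp (invol_le_of_isMap hf hf1) hg2

end

end Ssi

/-! ### Closed cribles -/

namespace ClosedCrible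

variable {C : Type u} [Category.{v} C] {J : GrothendieckTopology C} {X Y Z : C}

theorem iSup_rel {ι : Type*} {R : ι → ClosedCrible J X Y} {U : C} {f : U ⟶ X} {g : U ⟶ Y} :
    (⨆ i, R i).rel f g ↔ ∃ S : Sieve U, S ∈ J U ∧
      ∀ ⦃V : C⦄ (k : V ⟶ U), S k → ∃ i, (R i).rel (k ≫ f) (k ≫ g) := by
  refine exists_congr fun S => and_congr_right fun _ => forall_congr' fun V =>
    forall_congr' fun k => imp_congr_right fun _ => ?_
  exact Set.exists_range_iff (p := fun R : ClosedCrible J X Y => R.rel (k ≫ f) (k ≫ g))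

/-- The intersection of two closed cribles. -/
def inter (R S : ClosedCrible J X Y) : ClosedCrible J X Y where
  rel _ f g := R.rel f g ∧ S.rel f g
  precomp _ _ k _ _ h := ⟨R.precomp k h.1, S.precomp k h.2⟩
  closed _ f g T hT h := ⟨R.closed f g T hT fun _ k hk => (h k hk).1,
    S.closed f g T hT fun _ k hk => (h k hk).2⟩

theorem rel_symm {e : ClosedCrible J X X} (hs : op e = e) {U : C} {f g : U ⟶ X}
    (h : e.rel f g) : e.rel g f := by
  rw [← hs]
  exact h

/-- A symmetric idempotent is a partial equivalence relation on generalized elements. -/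
theorem rel_self {e : ClosedCrible J X X} (hi : comp e e = e) (hs : op e = e) {U : C}
    {f g : U ⟶ X} (h : e.rel f g) : e.rel f f := by
  rw [← hi]
  exact comp_rel h (rel_symm hs h)

theorem rel_self_left {e : ClosedCrible J X X} (hi : comp e e = e) (hs : op e = e)
    {R : ClosedCrible J X Y} (hR : comp e R = R) {U : C} {f : U ⟶ X} {g : U ⟶ Y}
    (h : R.rel f g) : e.rel f f := by
  rw [← hR] at h
  obtain ⟨S, hS, hk⟩ := h
  refine e.closed f f S hS fun V k hk' => ?_
  obtain ⟨_, h1, _⟩ := hk k hk'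
  exact rel_self hi hs h1

/-- The nontrivial inclusion holds because everything in the domain of `R` is `e`-related to itself.
Hence intersections of arrows of `Ssi` are again arrows of `Ssi`. -/
theorem comp_inter {e : ClosedCrible J X X} (hi : comp e e = e) (hs : op e = e)
    {R S : ClosedCrible J X Y} (hR : comp e R = R) (hS : comp e S = S) :
    comp e (inter R S) = inter R S := by
  refine le_antisymm ((comp_le_iff _ _ _).2 fun U f g h h1 h2 => ⟨?_, ?_⟩) fun U f g h =>
    comp_rel (rel_self_left hi hs hR h.1) h
  · rw [← hR]
    exact comp_rel h1 h2.1
  · rw [← hS]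
    exact comp_rel h1 h2.2

theorem inter_comp {e : ClosedCrible J Y Y} (hi : comp e e = e) (hs : op e = e)
    {R S : ClosedCrible J X Y} (hR : comp R e = R) (hS : comp S e = S) :
    comp (inter R S) e = inter R S := by
  have h : comp e (inter (op R) (op S)) = inter (op R) (op S) := by
    refine comp_inter hi hs ?_ ?_
    · have h' := congrArg op hR
      rwa [op_comp, hs] at h'
    · have h' := congrArg op hS
      rwa [op_comp, hs] at h'
  have h' := (op_comp e (inter (op R) (op S))).symm.trans (congrArg op h)
  rwa [hs] at h'

/-- If `p` and `q` are `e`-related, then locally some `w` satisfies `(p, w) ∈ R i` and `(w, p) ∈ S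
i`, so `(p, w)` lies in the intersection. Absorption of `e` transfers this to `(q, w)`, and `w` then
links `p` to `q`. -/
theorem le_iSup_inter {ι : Type*} {Y : ι → C} {e : ClosedCrible J X X} (hi : comp e e = e)
    (hs : op e = e) {R : ∀ i, ClosedCrible J X (Y i)} {S : ∀ i, ClosedCrible J (Y i) X}
    (hl : ∀ i, comp e (inter (R i) (op (S i))) = inter (R i) (op (S i)))
    (h : e ≤ ⨆ i, comp (R i) (S i)) :
    e ≤ ⨆ i, comp (inter (R i) (op (S i))) (op (inter (R i) (op (S i)))) := by
  intro U p q hpq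
  -- The cover is applied to `(p, p)` rather than `(p, q)`, so that both legs through `w` concern
  -- the same arrow.
  obtain ⟨T, hT, hk⟩ := iSup_rel.1 (h p p (rel_self hi hs hpq))
  refine ClosedCrible.closed _ p q T hT fun V k hk' => ?_
  obtain ⟨i, T', hT', hi'⟩ := hk k hk'
  refine ClosedCrible.closed _ _ _ T' hT' fun W l hl' => ?_
  obtain ⟨w, h1, h2⟩ := hi' l hl'
  have h3 : (inter (R i) (op (S i))).rel (l ≫ k ≫ q) w := by
    rw [← hl i]
    exact comp_rel (rel_symm hs (e.precomp l (e.precomp k hpq))) ⟨h1, h2⟩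
  have h4 : (inter (R i) (op (S i))).rel (l ≫ k ≫ p) w := ⟨h1, h2⟩
  exact le_iSup (fun i => comp (inter (R i) (op (S i))) (op (inter (R i) (op (S i))))) i _ _
    (comp_rel h4 h3)

/-- The crible represented by an arrow of the site: the closure of the spans `(k, k ≫ f)`. -/
def graph (J : GrothendieckTopology C) {U X : C} (f : U ⟶ X) : ClosedCrible J U X :=
  gen J (fun _ k l => k ≫ f = l) fun _ _ k _ _ h => by rw [Category.assoc, h]

theorem graph_rel {U V : C} (f : U ⟶ X) (k : V ⟶ U) : (graph J f).rel k (k ≫ f) :=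
  gen_of rfl

theorem one_le_graph {U : C} (f : U ⟶ X) : one J U ≤ comp (graph J f) (op (graph J f)) :=
  (gen_le_iff _).2 fun _ k l h => by
    subst h
    exact comp_rel (g := k ≫ f) (graph_rel f k) (graph_rel f k)

/-- A Yoneda argument: the composite is the closed crible generated by the single span `(f, g)`. -/
theorem op_graph_comp_graph_le_iff {U : C} (f : U ⟶ X) (g : U ⟶ Y) (R : ClosedCrible J X Y) :
    comp (op (graph J f)) (graph J g) ≤ R ↔ R.rel f g := by
  rw [comp_le_iff]
  constructor
  · intro h
    have hf := graph_rel (J := J) f (𝟙 U)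
    have hg := graph_rel (J := J) g (𝟙 U)
    rw [Category.id_comp] at hf hg
    exact h f (𝟙 U) g hf hg
  · rintro h V a k b ⟨S, hS, h1⟩ ⟨T, hT, h2⟩
    refine R.closed a b (S ⊓ T) (J.intersection_covering hS hT) fun W l hl => ?_
    rw [← h1 l hl.1, ← h2 l hl.2]
    exact R.precomp _ h

end ClosedCrible

/-! ### Weak tabularity and bilaterality of closed cribles -/

section Site

variable {C : Type u} [SmallCategory C] (J : GrothendieckTopology C)

theorem isMap_graph {U X : C} (f : U ⟶ X) :
    IsMap (Q := ClosedCribles J) (X := U) (Y := X) (ClosedCrible.graph J f) :=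
  ⟨ClosedCrible.one_le_graph f,
    (ClosedCrible.op_graph_comp_graph_le_iff f f (ClosedCrible.one J X)).2
      (ClosedCrible.gen_of rfl)⟩

theorem isWeaklyTabular_closedCribles : IsWeaklyTabular (ClosedCribles J) := by
  intro X Y q t h U f g hq
  have h1 := (ClosedCrible.op_graph_comp_graph_le_iff f g q).2 hq
  exact (ClosedCrible.op_graph_comp_graph_le_iff f g t).1
    (h _ _ (isMap_graph J f) (isMap_graph J g) h1)

theorem isBilateral_ssi_closedCribles : IsBilateral (Ssi (ClosedCribles J)) := by
  intro ι a b f g h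
  have hl (i : ι) := ClosedCrible.comp_inter (C := C) (J := J) a.idem a.symm (f i).left
    (invol (g i)).left
  have hr (i : ι) := ClosedCrible.inter_comp (C := C) (J := J) (b i).idem (b i).symm (f i).right
    (invol (g i)).right
  refine ⟨fun i => ⟨ClosedCrible.inter (f i).val (ClosedCrible.op (g i).val), hl i, hr i⟩,
    fun i _ _ _ h => h.1, fun i _ _ _ h => h.2, ?_⟩
  rw [Ssi.le_iff, Ssi.val_iSup] at h ⊢
  exact ClosedCrible.le_iSup_inter a.idem a.symm hl h

end Site

/-! ### Transport to an arbitrary quantaloid of closed cribles -/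

namespace IsQuantaloidOfClosedCribles

variable {Q : Type u} [InvolutiveQuantaloid.{u} Q] (hQ : IsQuantaloidOfClosedCribles Q)
include hQ

theorem isBilateral_ssi : IsBilateral (Ssi Q) := by
  obtain ⟨C, _, J, F, _, h1, h2⟩ := hQ
  have hF : IsQuantaloidHom F := ⟨h1, h2⟩
  exact (Ssi.isQuantaloidHom_mapFunctor hF).isBilateral (isBilateral_ssi_closedCribles J)

theorem isBilateral : IsBilateral Q :=
  Ssi.isQuantaloidHom_embedding.isBilateral hQ.isBilateral_ssi

theorem isWeaklyTabular : IsWeaklyTabular Q := by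
  obtain ⟨C, _, J, F, _, h1, h2⟩ := hQ
  have hF : IsQuantaloidHom F := ⟨h1, h2⟩
  exact hF.isWeaklyTabular
    (Ssi.isQuantaloidHom_embedding.isBilateral (isBilateral_ssi_closedCribles J))
    (isWeaklyTabular_closedCribles J)

theorem isWeaklyTabular_ssi : IsWeaklyTabular (Ssi Q) :=
  Ssi.isWeaklyTabular hQ.isBilateral hQ.isWeaklyTabular

end IsQuantaloidOfClosedCribles

/-! ### Left adjoint distributors and discrete objects -/

namespace QCat

section

variable {Q : Type u} [Quantaloid.{u} Q]

namespace Distributor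

variable {A B : QCat Q}

/-- `Φ` is left adjoint to `Ψ` in `Dist(Q)`. -/
abbrev AdjTo (Φ : Distributor A B) (Ψ : Distributor B A) : Prop :=
  Adj (Q := DistQ Q) (X := A) (Y := B) Φ Ψ

/-- The unit needs checking only against identities on the diagonal, because the composite
distributor absorbs the homs of `A`. -/
theorem adjTo_iff (Φ : Distributor A B) (Ψ : Distributor B A) : AdjTo Φ Ψ ↔
    (∀ {X : Q} (x : A.obj X), 𝟙 X ≤ ⨆ (Y : Q) (y : B.obj Y), Φ.app y x ≫ Ψ.app x y) ∧
    ∀ {X Y Y' : Q} (x : A.obj X) (y : B.obj Y) (y' : B.obj Y'),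
      Ψ.app x y ≫ Φ.app y' x ≤ B.hom y' y := by
  constructor
  · intro h
    exact ⟨fun x => (A.id_le x).trans (h.1 x x),
      fun x y y' => (le_comp_app Ψ Φ y x y').trans (h.2 y y')⟩
  · rintro ⟨h1, h2⟩
    constructor
    · intro X X' x x'
      refine (le_comp_of_one_le (h1 x) (A.hom x' x)).trans ?_
      simp only [iSup_comp, Category.assoc]
      exact iSup₂_mono fun Y y => comp_le_right _ (Ψ.app_comp_le y x x')
    · exact (comp_le_iff Ψ Φ (one B)).2 fun y x y' => h2 x y y'

/-- The distributor `B(F-, -)` corepresented by a functor `F : A → B`. -/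
def coFunctor (F : A ⟶ B) : Distributor B A where
  app x y := B.hom (Functor.map F x) y
  app_comp_le _ x x' := (comp_le_right _ (Functor.hom_le F x x')).trans (B.comp_le _ _ _)
  comp_app_le y y' _ := B.comp_le y' y _

theorem adjTo_ofFunctor (F : A ⟶ B) : AdjTo (ofFunctor F) (coFunctor F) := by
  rw [adjTo_iff]
  constructor
  · intro X x
    refine le_iSup₂_of_le X (Functor.map F x) ?_
    exact (B.id_le _).trans (le_comp_of_one_le (B.id_le _) _)
  · intro X Y Y' x y y'
    exact B.comp_le y _ y'

theorem ofFunctor_le_iff (F G : A ⟶ B) : ofFunctor F ≤ ofFunctor G ↔ F ≤ G := by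
  constructor
  · intro h X x
    exact (B.id_le _).trans (h x (Functor.map F x))
  · intro h X Y x y
    exact (le_comp_of_one_le (h x) _).trans (B.comp_le _ _ y)

end Distributor

/-! ### Cauchy completion of a one-object category -/

open Distributor

/-- The category of left adjoints into `X`: the Cauchy completion of the category with a single
object of type `X`. -/
def leftAdjointsInto (X : Q) : QCat Q where
  obj Z := {p : (Z ⟶ X) × (X ⟶ Z) // Adj p.1 p.2}
  hom q p := p.1.1 ≫ q.1.2
  id_le p := p.2.1
  comp_le p q r := by
    rw [Category.assoc]
    refine comp_le_right _ ?_
    rw [← Category.assoc]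
    exact comp_le_of_le_one q.2.2 _

/-- The identity of `X`, as an object of the category of left adjoints into `X`. -/
def idInto (X : Q) : (leftAdjointsInto X).obj X :=
  ⟨(𝟙 X, 𝟙 X), adj_id X⟩

/-- The homs between `p` and `idInto X` are the two halves of the adjunction `p`; acting with each
in turn gives the two inequalities. A distributor is thus determined by its values at `idInto X`. -/
theorem app_eq_of_leftAdjointsInto {B : QCat Q} {X Y Z : Q}
    (Φ : Distributor B (leftAdjointsInto X)) (b : B.obj Y) (p : (leftAdjointsInto X).obj Z) :
    Φ.app p b = Φ.app (idInto X) b ≫ p.1.2 := by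
  apply le_antisymm
  · refine (le_comp_of_one_le' p.2.1 _).trans ?_
    rw [← Category.assoc]
    refine comp_le_left _ ?_
    simpa [leftAdjointsInto, idInto] using Φ.app_comp_le b p (idInto X)
  · simpa [leftAdjointsInto, idInto] using Φ.app_comp_le b (idInto X) p

theorem app_eq_of_leftAdjointsInto' {B : QCat Q} {X Y Z : Q}
    (Ψ : Distributor (leftAdjointsInto X) B) (b : B.obj Y) (p : (leftAdjointsInto X).obj Z) :
    Ψ.app b p = p.1.1 ≫ Ψ.app b (idInto X) := by
  apply le_antisymm
  · refine (le_comp_of_one_le p.2.1 _).trans ?_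
    rw [Category.assoc]
    refine comp_le_right _ ?_
    simpa [leftAdjointsInto, idInto] using Ψ.comp_app_le p (idInto X) b
  · simpa [leftAdjointsInto, idInto] using Ψ.comp_app_le (idInto X) p b

theorem isCauchyComplete_leftAdjointsInto (X : Q) : IsCauchyComplete (leftAdjointsInto X) := by
  rintro B Φ ⟨Ψ, h⟩
  obtain ⟨h1, h2⟩ := (adjTo_iff Φ Ψ).1 h
  have hadj {Y : Q} (b : B.obj Y) : Adj (Φ.app (idInto X) b) (Ψ.app b (idInto X)) := by
    constructor
    · refine (h1 b).trans (iSup₂_le fun Z p => ?_)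
      rw [app_eq_of_leftAdjointsInto Φ b p, app_eq_of_leftAdjointsInto' Ψ b p, Category.assoc,
        ← Category.assoc p.1.2]
      exact comp_le_right _ (comp_le_of_le_one p.2.2 _)
    · simpa [leftAdjointsInto, idInto] using h2 b (idInto X) (idInto X)
  -- The values at the identity form an adjoint pair in `Q`, hence an object of `leftAdjointsInto
  -- X`, and this object represents `Φ` at `b`.
  refine ⟨⟨fun b => ⟨(Φ.app (idInto X) b, Ψ.app b (idInto X)), hadj b⟩, fun b b' => ?_⟩, ?_⟩
  · change B.hom b' b ≤ Φ.app (idInto X) b ≫ Ψ.app b' (idInto X)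
    refine (le_comp_of_one_le' (hadj b').1 _).trans ?_
    rw [← Category.assoc]
    exact comp_le_left _ (Φ.comp_app_le b' b _)
  · ext Y Z p b
    exact app_eq_of_leftAdjointsInto Φ b p

namespace Distributor

variable {A B : QCat Q} {X : Q}

/-- The distributor on the left adjoints into `X` given by an object of type `X`. -/
def restrict (Φ : Distributor B A) (b : B.obj X) : Distributor (leftAdjointsInto X) A where
  app y p := p.1.1 ≫ Φ.app y b
  app_comp_le p y y' := by
    rw [Category.assoc]
    exact comp_le_right _ (Φ.app_comp_le b y y')
  comp_app_le p p' y := by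
    change (p'.1.1 ≫ p.1.2) ≫ p.1.1 ≫ Φ.app y b ≤ _
    rw [Category.assoc, ← Category.assoc p.1.2]
    exact comp_le_right _ (comp_le_of_le_one p.2.2 _)

/-- The distributor into the left adjoints into `X` given by an object of type `X`. -/
def corestrict (Ψ : Distributor A B) (b : B.obj X) : Distributor A (leftAdjointsInto X) where
  app p y := Ψ.app b y ≫ p.1.2
  app_comp_le y p p' := by
    change (Ψ.app b y ≫ p.1.2) ≫ p.1.1 ≫ p'.1.2 ≤ _
    rw [Category.assoc, ← Category.assoc p.1.2]
    exact comp_le_right _ (comp_le_of_le_one p.2.2 _)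
  comp_app_le y y' p := by
    rw [← Category.assoc]
    exact comp_le_left _ (Ψ.comp_app_le y y' b)

theorem AdjTo.restrict {Φ : Distributor B A} {Ψ : Distributor A B} (h : AdjTo Φ Ψ)
    (b : B.obj X) : AdjTo (Φ.restrict b) (Ψ.corestrict b) := by
  obtain ⟨h1, h2⟩ := (adjTo_iff Φ Ψ).1 h
  rw [adjTo_iff]
  constructor
  · intro Z p
    refine p.2.1.trans ((comp_le_right _ (le_comp_of_one_le (h1 b) _)).trans ?_)
    simp only [iSup_comp, comp_iSup]
    refine iSup₂_mono fun Y y => le_of_eq ?_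
    change _ = (p.1.1 ≫ Φ.app y b) ≫ Ψ.app b y ≫ p.1.2
    simp
  · intro Z Y Y' p y y'
    change (Ψ.app b y ≫ p.1.2) ≫ p.1.1 ≫ Φ.app y' b ≤ _
    rw [Category.assoc, ← Category.assoc p.1.2]
    exact (comp_le_right _ (comp_le_of_le_one p.2.2 _)).trans (h2 b y y')

theorem adjTo_one (A : QCat Q) : AdjTo (one A) (one A) :=
  adj_id (Q := DistQ Q) A

end Distributor

/-- In a Cauchy complete category, objects can be restricted along left adjoints. -/
theorem IsCauchyComplete.exists_functor {A : QCat Q} (hA : IsCauchyComplete A) {X : Q}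
    (a : A.obj X) : ∃ F : leftAdjointsInto X ⟶ A, ∀ {Y Z : Q} (y : A.obj Y)
      (p : (leftAdjointsInto X).obj Z), A.hom y (Functor.map F p) = p.1.1 ≫ A.hom y a := by
  -- The distributor `p ↦ p ≫ A(-, a)` is a left adjoint; the object representing it at `p` is the
  -- restriction `a · p`.
  obtain ⟨F, hF⟩ := hA _ ((one A).restrict a) ⟨_, (adjTo_one A).restrict a⟩
  refine ⟨F, fun y p => ?_⟩
  have h : ((one A).restrict a).app y p = (ofFunctor F).app y p := by rw [hF]
  exact h.symm

/-- A Cauchy complete category is discrete exactly when the underlying order of its objects is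
symmetric. -/
theorem isDiscreteObj_iff (A : CatCC Q) : IsDiscreteObj A ↔
    ∀ {X : Q} (a b : A.obj.obj X), 𝟙 X ≤ A.obj.hom a b → 𝟙 X ≤ A.obj.hom b a := by
  constructor
  · intro hA X a b hab
    obtain ⟨F, hF⟩ := A.property.exists_functor a
    obtain ⟨G, hG⟩ := A.property.exists_functor b
    -- Test objects must be Cauchy complete, so the one-object category is replaced by its
    -- completion. At `idInto X` the functors `F` and `G` give objects isomorphic to `a` and `b`.
    let T : CatCC Q := ⟨leftAdjointsInto X, isCauchyComplete_leftAdjointsInto X⟩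
    have hFa {Y : Q} (y : A.obj.obj Y) :
        A.obj.hom y (Functor.map F (idInto X)) = A.obj.hom y a := by
      rw [hF]
      exact Category.id_comp _
    have hGb {Y : Q} (y : A.obj.obj Y) :
        A.obj.hom y (Functor.map G (idInto X)) = A.obj.hom y b := by
      rw [hG]
      exact Category.id_comp _
    have hle : F ≤ G := by
      intro Z p
      refine (A.obj.id_le (Functor.map F p)).trans ?_
      rw [hF, hG]
      exact comp_le_right _ ((le_comp_of_one_le hab _).trans (A.obj.comp_le _ _ _))
    have hge : G ≤ F :=
      hA T (ObjectProperty.homMk F) (ObjectProperty.homMk G) hle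
    have h1 := hge (idInto X)
    rw [hFa] at h1
    have h2 : 𝟙 X ≤ A.obj.hom b (Functor.map G (idInto X)) := by
      rw [hGb]
      exact A.obj.id_le b
    exact (le_comp_of_one_le h1 _ |>.trans (A.obj.comp_le _ _ b)).trans' h2
  · intro h X f g hfg Z x
    exact h _ _ (hfg x)

/-- Discreteness can be tested on left adjoint distributors. -/
theorem isMapDiscreteObj_iff (D : DistCC Q) :
    IsMapDiscreteObj D ↔ IsDiscreteObj (⟨D.obj, D.property⟩ : CatCC Q) := by
  constructor
  · intro h X f g hfg
    let X' : DistCC Q := ⟨X.obj, X.property⟩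
    have hl (f : X ⟶ ⟨D.obj, D.property⟩) : IsLeftAdjoint (X := X') (Y := D)
        (ObjectProperty.homMk (ofFunctor f.hom)) :=
      ⟨ObjectProperty.homMk (coFunctor f.hom), adjTo_ofFunctor f.hom⟩
    have h1 := h X' _ _ (hl f) (hl g) ((ofFunctor_le_iff f.hom g.hom).2 hfg)
    exact (ofFunctor_le_iff g.hom f.hom).1 h1
  · rintro h X Φ Ψ ⟨Φ', hΦ⟩ ⟨Ψ', hΨ⟩ hle
    let X' : CatCC Q := ⟨X.obj, X.property⟩
    let D' : CatCC Q := ⟨D.obj, D.property⟩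
    obtain ⟨F, hF⟩ : ∃ F : X'.obj ⟶ D'.obj, Φ.hom = ofFunctor F :=
      D.property X.obj Φ.hom ⟨Φ'.hom, hΦ⟩
    obtain ⟨G, hG⟩ : ∃ G : X'.obj ⟶ D'.obj, Ψ.hom = ofFunctor G :=
      D.property X.obj Ψ.hom ⟨Ψ'.hom, hΨ⟩
    have hFG : ofFunctor F ≤ ofFunctor G := by
      rw [← hF, ← hG]
      exact hle
    have hGF : G ≤ F :=
      h X' (ObjectProperty.homMk F) (ObjectProperty.homMk G) ((ofFunctor_le_iff F G).1 hFG)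
    have hle' := (ofFunctor_le_iff G F).2 hGF
    rw [← hF, ← hG] at hle'
    exact hle'

end

/-! ### Symmetry -/

variable {Q : Type u} [InvolutiveQuantaloid.{u} Q]

open Distributor

theorem IsSymmetric.isDiscreteObj {A : CatCC Q} (hA : A.obj.IsSymmetric) : IsDiscreteObj A := by
  rw [isDiscreteObj_iff]
  intro X a b h
  rw [hA b a, ← invol_id]
  exact invol_mono h

/-- For maps `f` and `g`, the inequality `f° ≫ g ≤ A(y, x)` amounts to `1 ≤ A(y · g, x · f)`, where
`x · f` and `y · g` are restrictions along `f` and `g`; discreteness reverses the latter. -/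
theorem isSymmetric_of_isDiscreteObj (ht : IsWeaklyTabular Q) {A : CatCC Q}
    (hA : IsDiscreteObj A) : A.obj.IsSymmetric := by
  rw [isDiscreteObj_iff] at hA
  suffices h : ∀ {X Y : Q} (x : A.obj.obj X) (y : A.obj.obj Y),
      A.obj.hom y x ≤ invol (A.obj.hom x y) by
    intro X Y x y
    exact le_antisymm (h y x) (invol_le_iff.2 (h x y))
  intro X Y x y
  -- In what follows, `F p` is the restriction `x · f` and `G q` is `y · g`, with maps viewed as
  -- adjoint pairs.
  refine ht _ _ fun U f g hf hg hq => ?_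
  obtain ⟨F, hF⟩ := A.property.exists_functor x
  obtain ⟨G, hG⟩ := A.property.exists_functor y
  let p : (leftAdjointsInto X).obj U := ⟨(f, invol f), hf⟩
  let q : (leftAdjointsInto Y).obj U := ⟨(g, invol g), hg⟩
  have hF' {Z : Q} (z : A.obj.obj Z) : A.obj.hom z (Functor.map F p) = f ≫ A.obj.hom z x := hF z p
  have hG' {Z : Q} (z : A.obj.obj Z) : A.obj.hom z (Functor.map G q) = g ≫ A.obj.hom z y := hG z q
  have hle : 𝟙 U ≤ A.obj.hom (Functor.map G q) (Functor.map F p) := by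
    have h1 : g ≤ A.obj.hom y (Functor.map F p) := by
      rw [hF']
      refine (le_comp_of_one_le hf.1 g).trans ?_
      rw [Category.assoc]
      exact comp_le_right f hq
    have h2 : invol g ≤ A.obj.hom (Functor.map G q) y := by
      refine (le_comp_of_one_le' (A.obj.id_le (Functor.map G q)) _).trans ?_
      rw [hG', ← Category.assoc]
      exact comp_le_of_le_one hg.2 _
    exact (hg.1.trans (comp_le_comp h1 h2)).trans (A.obj.comp_le _ _ _)
  have hge := hA _ _ hle
  rw [hG'] at hge
  have h3 : f ≤ A.obj.hom x (Functor.map F p) := by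
    rw [hF']
    exact le_comp_of_one_le' (A.obj.id_le x) f
  -- The reversed inequality `𝟙 ≤ A(x · f, y · g) = g ≫ A(x · f, y)` transposes to `g° ≤ A(x · f,
  -- y)`, which composes with `f ≤ A(x, x · f)`.
  have h4 : invol g ≫ f ≤ A.obj.hom x y := by
    have h5 : invol g ≤ A.obj.hom (Functor.map F p) y := by
      refine (le_comp_of_one_le' hge _).trans ?_
      rw [← Category.assoc]
      exact comp_le_of_le_one hg.2 _
    exact (comp_le_comp h5 h3).trans (A.obj.comp_le _ _ _)
  rw [← invol_le_iff, invol_comp, invol_invol]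
  exact h4

theorem isDiscreteObj_iff_isSymmetric (ht : IsWeaklyTabular Q) (A : CatCC Q) :
    IsDiscreteObj A ↔ A.obj.IsSymmetric :=
  ⟨isSymmetric_of_isDiscreteObj ht, IsSymmetric.isDiscreteObj⟩

/-- The right adjoint of a left adjoint distributor into a symmetric category is, objectwise, its
involute. -/
theorem IsSymmetric.eq_invol_of_adjTo (hb : IsBilateral Q) {A B : QCat Q} (hA : A.IsSymmetric)
    {Φ : Distributor B A} {Ψ : Distributor A B} (h : AdjTo Φ Ψ) {X Y : Q} (b : B.obj X)
    (a : A.obj Y) : Ψ.app b a = invol (Φ.app a b) := by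
  obtain ⟨h1, h2⟩ := (adjTo_iff Φ Ψ).1 h
  -- The unit at `b` is one cover indexed by all objects of `A`. Its symmetric refinement does the
  -- work of `IsBilateral.eq_invol`, with symmetry of `A` turning the counit bounds around. `B` need
  -- not be symmetric.
  have hsig : 𝟙 X ≤ ⨆ i : Σ Y : Q, A.obj Y, Φ.app i.2 b ≫ Ψ.app b i.2 := by
    rw [iSup_sigma]
    exact h1 b
  obtain ⟨k, hk1, hk2, hk3⟩ := hb (ι := Σ Y : Q, A.obj Y) (fun i => i.1)
    (fun i => Φ.app i.2 b) (fun i => Ψ.app b i.2) hsig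
  apply le_antisymm
  · refine (le_comp_of_one_le' hk3 _).trans ?_
    rw [comp_iSup]
    refine iSup_le fun i => ?_
    rw [← Category.assoc]
    calc (Ψ.app b a ≫ k i) ≫ invol (k i)
        ≤ invol (A.hom a i.2) ≫ invol (Φ.app i.2 b) := by
          refine comp_le_comp ?_ (invol_mono (hk1 i))
          rw [← hA]
          exact (comp_le_right _ (hk1 i)).trans (h2 b a i.2)
      _ = invol (Φ.app i.2 b ≫ A.hom a i.2) := (invol_comp _ _).symm
      _ ≤ invol (Φ.app a b) := invol_mono (Φ.app_comp_le b i.2 a)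
  · rw [invol_le_iff]
    refine (le_comp_of_one_le hk3 _).trans ?_
    rw [iSup_comp]
    refine iSup_le fun i => ?_
    rw [Category.assoc]
    calc k i ≫ invol (k i) ≫ Φ.app a b
        ≤ invol (Ψ.app b i.2) ≫ invol (A.hom i.2 a) := by
          refine comp_le_comp (hk2 i) ?_
          rw [← hA]
          exact (comp_le_left _ (invol_le_iff.2 (hk2 i))).trans (h2 b i.2 a)
      _ = invol (A.hom i.2 a ≫ Ψ.app b i.2) := (invol_comp _ _).symm
      _ ≤ invol (Ψ.app b a) := invol_mono (Ψ.comp_app_le i.2 a b)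

theorem isSymmetric_leftAdjointsInto (hb : IsBilateral Q) (X : Q) :
    (leftAdjointsInto X).IsSymmetric := by
  intro Y Z p q
  change q.1.1 ≫ p.1.2 = invol (p.1.1 ≫ q.1.2)
  rw [invol_comp, hb.eq_invol p.2, hb.eq_invol q.2, invol_invol]

/-- Over a bilateral quantaloid, symmetrically complete categories are Cauchy complete. -/
theorem IsSymComplete.isCauchyComplete (hb : IsBilateral Q) {A : QCat Q} (hA : IsSymComplete A) :
    IsCauchyComplete A := by
  obtain ⟨hs, hc⟩ := hA
  rintro B Φ ⟨Ψ, h⟩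
  -- Symmetric completeness sees only symmetric domains and `B` is arbitrary, so `Φ` is restricted
  -- to the symmetric category `leftAdjointsInto X`; evaluating the resulting functor at the
  -- identity represents `Φ` at `b`.
  have hex {X : Q} (b : B.obj X) :
      ∃ a : A.obj X, ∀ {Y : Q} (y : A.obj Y), Φ.app y b = A.hom y a := by
    have hadj := AdjTo.restrict h b
    have heq : (Φ.restrict b).involute (isSymmetric_leftAdjointsInto hb X) hs =
        Ψ.corestrict b := by
      ext Z Y p y
      exact (hs.eq_invol_of_adjTo hb hadj p y).symm
    obtain ⟨F, hF⟩ := hc _ (isSymmetric_leftAdjointsInto hb X) (Φ.restrict b) (by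
      rw [heq]
      exact hadj)
    refine ⟨Functor.map F (idInto X), fun {Y} y => ?_⟩
    have h1 : (Φ.restrict b).app y (idInto X) = (ofFunctor F).app y (idInto X) := by rw [hF]
    exact (Category.id_comp _).symm.trans h1
  choose m hm using @hex
  refine ⟨⟨fun b => m b, fun b b' => ?_⟩, ?_⟩
  · rw [← hm b]
    -- Functoriality: `𝟙 ≤ A(m b', m b') = Φ(m b', b')`, and `B(b', b)` acts on this element.
    refine (le_comp_of_one_le' (A.id_le (m b')) _).trans ?_
    rw [← hm b' (m b')]
    exact Φ.comp_app_le b' b _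
  · ext Y X y b
    exact hm b y

theorem IsCauchyComplete.isSymComplete {A : QCat Q} (hA : IsCauchyComplete A)
    (hs : A.IsSymmetric) : IsSymComplete A :=
  ⟨hs, fun B _ Φ h => hA B Φ ⟨_, h⟩⟩

end QCat

/-- The inclusion of a full subquantaloid into a larger one preserves suprema. -/
theorem ιOfLE_map_sSup {Q : Type u} [Quantaloid.{v} Q] {P P' : ObjectProperty Q} (h : P ≤ P')
    {A B : P.FullSubcategory} (s : Set (A ⟶ B)) :
    (ObjectProperty.ιOfLE h).map (sSup s) = ⨆ f ∈ s, (ObjectProperty.ιOfLE h).map f := by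
  refine le_antisymm ?_ (iSup₂_le fun f hf => ?_)
  · change (⨆ f ∈ s, f.hom) ≤ (⨆ f ∈ s, (ObjectProperty.ιOfLE h).map f).hom
    exact iSup₂_le fun f hf =>
      le_iSup₂ (f := fun f (_ : f ∈ s) => (ObjectProperty.ιOfLE h).map f) f hf
  · exact le_iSup₂ (f := fun (f : A ⟶ B) (_ : f ∈ s) => f.hom) f hf

theorem mainTheorem9 (Q : Type u) [InvolutiveQuantaloid.{u} Q]
    (hQ : IsQuantaloidOfClosedCribles Q) :
    (∀ A : CatCC Q, IsDiscreteObj A ↔ A.obj.IsSymmetric) ∧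
    (∃ h : QCat.IsSymComplete (Q := Ssi Q) ≤ QCat.IsCauchyComplete,
      (ObjectProperty.ιOfLE h : Sh Q ⥤ OrdSsi Q).Full ∧
      (ObjectProperty.ιOfLE h : Sh Q ⥤ OrdSsi Q).Faithful ∧
      (∀ (A B : Sh Q) (F G : A ⟶ B),
        F ≤ G ↔ (ObjectProperty.ιOfLE h).map F ≤ (ObjectProperty.ιOfLE h).map G) ∧
      ∀ D : OrdSsi Q, IsDiscreteObj D ↔ ∃ A : Sh Q, (ObjectProperty.ιOfLE h).obj A = D) ∧
    (∃ h : distIsSC (Ssi Q) ≤ distIsCC (Ssi Q),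
      (ObjectProperty.ιOfLE h : RelQ Q ⥤ IdlSsi Q).Full ∧
      (ObjectProperty.ιOfLE h : RelQ Q ⥤ IdlSsi Q).Faithful ∧
      (∀ (A B : RelQ Q) (s : Set (A ⟶ B)),
        (ObjectProperty.ιOfLE h).map (sSup s) = ⨆ Φ ∈ s, (ObjectProperty.ιOfLE h).map Φ) ∧
      ∀ D : IdlSsi Q,
        (IsDiscreteObj D.toOrd ↔ ∃ A : RelQ Q, (ObjectProperty.ιOfLE h).obj A = D) ∧
        (Quantaloid.IsMapDiscreteObj D ↔ ∃ A : RelQ Q, (ObjectProperty.ιOfLE h).obj A = D)) := by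
  have hb := hQ.isBilateral_ssi
  have ht := hQ.isWeaklyTabular_ssi
  have hcc : QCat.IsSymComplete (Q := Ssi Q) ≤ QCat.IsCauchyComplete :=
    fun _ hA => hA.isCauchyComplete hb
  have hcc' : distIsSC (Ssi Q) ≤ distIsCC (Ssi Q) := hcc
  have hSh (D : OrdSsi Q) :
      IsDiscreteObj D ↔ ∃ A : Sh Q, (ObjectProperty.ιOfLE hcc).obj A = D := by
    rw [QCat.isDiscreteObj_iff_isSymmetric ht]
    constructor
    · exact fun h => ⟨⟨D.obj, D.property.isSymComplete h⟩, rfl⟩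
    · rintro ⟨A, rfl⟩
      exact A.property.1
  have hRel (D : IdlSsi Q) :
      IsDiscreteObj D.toOrd ↔ ∃ A : RelQ Q, (ObjectProperty.ιOfLE hcc').obj A = D := by
    rw [QCat.isDiscreteObj_iff_isSymmetric ht]
    constructor
    · exact fun h => ⟨⟨D.obj, QCat.IsCauchyComplete.isSymComplete D.property h⟩, rfl⟩
    · rintro ⟨A, rfl⟩
      exact A.property.1
  -- The first claim uses weak tabularity of `Q` itself; the other two use both properties of `Ssi
  -- Q`.
  exact ⟨QCat.isDiscreteObj_iff_isSymmetric hQ.isWeaklyTabular,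
    ⟨hcc, inferInstance, inferInstance, fun _ _ _ _ => Iff.rfl, hSh⟩,
    ⟨hcc', inferInstance, inferInstance, fun _ _ s => ιOfLE_map_sSup hcc' s,
      fun D => ⟨hRel D, (QCat.isMapDiscreteObj_iff D).trans (hRel D)⟩⟩⟩
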